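/- For $x\in\mathbb{Z}$, $t\ge 0$ put $$K_{x,t}(z,w)=\frac{z^{|x|}e^{\varepsilon(z)t}}{zw+1-2w},\qquad \varepsilon(z)=z+\frac1z-2 ,$$ and for $n\ge 1$ let $$I_n(x,t)=\operatorname{Tr}K_{x,t}^n=\frac{1}{(2\pi i)^n}\oint_{C_0}\!\cdots\oint_{C_0}K_{x,t}(z_1,z_2)K_{x,t}(z_2,z_3)\cdots K_{x,t}(z_n,z_1)\,dz_1\cdots dz_n ,$$ where $C_0$ is the counterclockwise circle $|z|=r$ with $r>0$ so small that $zw+1-2w\neq0$ whenever $|z|,|w|\le r$. Let $$\operatorname{erfc}(z)=\frac{2}{\sqrt\pi}\int_z^\infty e^{-u^2}\,du,\qquad \Xi(\xi)=\int_\xi^\infty\operatorname{erfc}(u)\,du,\qquad \Xi_n(\xi)=\frac1{\sqrt n}\,\Xi(\sqrt n\,\xi).$$ Then for every $n\ge1$ and every fixed real $\xi\le 0$, if $t\to\infty$ and the integer $x=x(t)\ge0$ varies with $t$ so that $x=-2\xi\sqrt t$, or more generally so that $x/\sqrt t\to-2\xi$ (for instance $x=\lfloor-2\xi\sqrt t\rfloor$),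 one has $$I_n(x,t)\sim\sqrt t\;\Xi_n(-\xi),\qquad\text{i.e.}\qquad \lim_{t\to\infty}\frac{I_n(x,t)}{\sqrt t\,\Xi_n(-\xi)}=1 .$$ -/

import Mathlib

open Filter Topology

noncomputable section

namespace SEP

/-- The dispersion function `ε(z) = z + 1/z - 2`. -/
def eps (z : ℂ) : ℂ := z + 1 / z - 2

/-- The kernel `K_{x,t}(z, w) = z ^ |x| * exp (ε(z) t) / (z w + 1 - 2 w)`. -/
def kernel (x : ℤ) (t : ℝ) (z w : ℂ) : ℂ :=
  z ^ x.natAbs * Complex.exp (eps z * (t : ℂ)) / (z * w + 1 - 2 * w)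

/-- The radius `r` is positive and so small that no pole of `1 / (z w + 1 - 2 w)` is met when
both variables range over the closed disc of radius `r` around the origin. -/
def IsSmallRadius (r : ℝ) : Prop :=
  0 < r ∧ ∀ z w : ℂ, ‖z‖ ≤ r → ‖w‖ ≤ r → z * w + 1 - 2 * w ≠ 0

/-- The trace `I_n(x,t) = Tr K_{x,t}^n`, that is, the `n`-fold contour integral of
`K_{x,t}(z₁, z₂) K_{x,t}(z₂, z₃) ⋯ K_{x,t}(zₙ, z₁)` in which every variable runs counterclockwise
over the circle of radius `r` around the origin and every integral carries the factor
`1 / (2πi)`. The indices are taken cyclically (`finRotate n` is the map `j ↦ j + 1`). -/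
def traceI (r : ℝ) (n : ℕ) (x : ℤ) (t : ℝ) : ℂ :=
  (2 * (Real.pi : ℂ) * Complex.I)⁻¹ ^ n *
    torusIntegral (fun z : Fin n → ℂ => ∏ j : Fin n, kernel x t (z j) (z (finRotate n j)))
      (fun _ => 0) (fun _ => r)

/-- The complementary error function. -/
def erfc (z : ℝ) : ℝ := 2 / √Real.pi * ∫ u in Set.Ioi z, Real.exp (-u ^ 2)

/-- `Ξ(ξ) = ∫_ξ^∞ erfc(u) du`. -/
def Xi (ξ : ℝ) : ℝ := ∫ u in Set.Ioi ξ, erfc u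

/-- `Ξ_n(ξ) = n^{-1/2} Ξ(√n ξ)`. -/
def XiN (n : ℕ) (ξ : ℝ) : ℝ := 1 / √(n : ℝ) * Xi (√(n : ℝ) * ξ)

end SEP

end

/-!
Everything rests on an exact formula for the trace, valid for every `t ≥ 0` and every integer
`x ≥ 0`, in which all oscillations have disappeared. Write `D(z, w) = z w + 1 - 2 w`.

Conjugating the kernel by `z ↦ exp (t / z)` does not change the trace and turns it into
`z ^ x * exp (t D / w) / D`, because `ε(z) + 1 / w - 1 / z = D(z, w) / w`. The pole at `D = 0` can
now be subtracted: the difference between this kernel and its value `z ^ x / D` at `t = 0` is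
`∫ s in 0..t, z ^ x * exp (s (z - 1)) * exp (s (1 / w - 1)) / w`, while a cyclic product with at
least one factor `z ^ x / D` is holomorphic in the second variable of that factor and integrates to
zero (`torusIntegral_prod_twistedKernel_eq`). After Fubini the circle integrals decouple, and
`I_n(x, t)` becomes the integral over `[0, t] ^ n` of `∏ S(σ_j, σ_{j + 1})`, where `S(a, b)` is the
probability that a Poisson variable with parameter `a` exceeds an independent one with parameter
`b` by `x` (`traceI_eq_integral`). In other words, `I_n` is the trace of the `n`-th power of a
nonnegative, substochastic kernel on `[0, t]` (`traceI_eq_integral_iterKernel`).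

Near the diagonal point `t s`, with `0 < s < 1`, and on the scale `√t`, the local limit theorem
(`tendsto_sqrt_mul_skellam`) shows that `S` is asymptotically a Gaussian density with variance
`2 s`, centred at a displacement proportional to `x`. Because the kernel is positive and
substochastic, Scheffé's lemma upgrades pointwise convergence to `L¹` convergence, so its powers
converge to the corresponding Gaussian convolutions (`tendsto_sqrt_mul_iterKernel`). The bound
`S(a, b) ≤ 1 / √b` is inherited by the powers and dominates the diagonal, so that
`I_n / √t` converges to the integral over `s ∈ (0, 1)` of a Gaussian density with variance
`2 s n` at `n c`, where `c = -2 ξ` is the limit of `x / √t`. An explicit antiderivative identifies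
this integral with `Ξ_n (c / 2)` (`integral_gauss_eq_XiN`).
-/

namespace SEP

open MeasureTheory Set Complex
open scoped Nat

/-! ### The Skellam kernel -/

/-- The Poisson weight `e^{-a} a^k / k!`. -/
noncomputable def poissonWeight (k : ℕ) (a : ℝ) : ℝ := Real.exp (-a) * a ^ k / k !

/-- The Skellam kernel: for `a, b ≥ 0`, the probability that a Poisson variable with parameter `a`
exceeds an independent one with parameter `b` by exactly `m`. The series that defines it converges
for all real `a` and `b`. -/
noncomputable def skellam (m : ℕ) (a b : ℝ) : ℝ :=
  ∑' k : ℕ, poissonWeight (k + m) a * poissonWeight k b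

/-- The exponential series may be integrated term by term along a circle. -/
lemma hasSum_circleIntegral_mul_exp {F g : ℂ → ℂ} {ρ : ℝ}
    (hF : ContinuousOn F (Metric.sphere 0 |ρ|)) (hg : ContinuousOn g (Metric.sphere 0 |ρ|)) :
    HasSum (fun k : ℕ => ∮ z in C(0, ρ), F z * (g z ^ k / k !))
      (∮ z in C(0, ρ), F z * exp (g z)) := by
  have hmem : ∀ θ, circleMap 0 ρ θ ∈ Metric.sphere (0 : ℂ) |ρ| := circleMap_mem_sphere' 0 ρ
  have hFc : Continuous fun θ => F (circleMap 0 ρ θ) :=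
    hF.comp_continuous (continuous_circleMap 0 ρ) hmem
  have hgc : Continuous fun θ => g (circleMap 0 ρ θ) :=
    hg.comp_continuous (continuous_circleMap 0 ρ) hmem
  obtain ⟨A, hA⟩ := (isCompact_sphere (0 : ℂ) |ρ|).exists_bound_of_continuousOn hF
  obtain ⟨M, hM⟩ := (isCompact_sphere (0 : ℂ) |ρ|).exists_bound_of_continuousOn hg
  unfold circleIntegral
  refine intervalIntegral.hasSum_integral_of_dominated_convergence
    (fun k _ => |ρ| * A * (M ^ k / k !)) ?_ ?_ ?_ ?_ ?_
  · intro k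
    refine Continuous.aestronglyMeasurable ?_
    have hc := continuous_circleMap (0 : ℂ) ρ
    simp only [deriv_circleMap, smul_eq_mul]
    exact (hc.mul continuous_const).mul (hFc.mul ((hgc.pow k).div_const _))
  · intro k
    refine .of_forall fun θ _ => ?_
    have h1 := hA _ (hmem θ)
    have h2 := hM _ (hmem θ)
    have h3 : ‖g (circleMap 0 ρ θ)‖ ^ k ≤ M ^ k := by gcongr
    have h4 : 0 ≤ A := (norm_nonneg _).trans h1
    simp only [deriv_circleMap, smul_eq_mul, norm_mul, norm_circleMap_zero, norm_I, mul_one,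
      norm_div, norm_pow, Complex.norm_natCast, ← mul_assoc]
    gcongr
  · exact .of_forall fun θ _ => (Real.summable_pow_div_factorial M).mul_left _
  · exact intervalIntegrable_const
  · refine .of_forall fun θ _ => ?_
    refine HasSum.const_smul _ (HasSum.mul_left _ ?_)
    rw [exp_eq_exp_ℂ]
    exact NormedSpace.exp_series_hasSum_exp' (𝕂 := ℂ) (g (circleMap 0 ρ θ)) |>.congr_fun (by
      intro k; simp [div_eq_inv_mul])

lemma circleIntegral_zpow_of_ne {ρ : ℝ} {j : ℤ} (hj : j ≠ -1) :
    (∮ z in C(0, ρ), z ^ j) = 0 := by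
  simpa using circleIntegral.integral_sub_zpow_of_ne hj 0 0 ρ

/-- The Laurent coefficient of `exp (a / z)`. -/
lemma circleIntegral_pow_mul_exp_div {ρ : ℝ} (hρ : 0 < ρ) (N : ℕ) (a : ℂ) :
    (∮ z in C(0, ρ), z ^ N * z⁻¹ * exp (a * z⁻¹)) = 2 * Real.pi * I * (a ^ N / N !) := by
  have hne : ∀ z ∈ Metric.sphere (0 : ℂ) |ρ|, z ≠ 0 := fun z hz h => by
    simp [h, hρ.ne, abs_of_pos hρ] at hz
  have hinv : ContinuousOn (fun z : ℂ => z⁻¹) (Metric.sphere 0 |ρ|) :=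
    continuousOn_id.inv₀ hne
  have h := hasSum_circleIntegral_mul_exp (ρ := ρ) (F := fun z => z ^ N * z⁻¹)
    (g := fun z => a * z⁻¹) (by fun_prop) (by fun_prop)
  refine h.unique ?_
  -- only the term `k = N` contains the power `z⁻¹`
  have hterm : ∀ k : ℕ, (∮ z in C(0, ρ), z ^ N * z⁻¹ * ((a * z⁻¹) ^ k / k !)) =
      (a ^ k / k !) * ∮ z in C(0, ρ), z ^ ((N : ℤ) - 1 - k) := by
    intro k
    rw [← circleIntegral.integral_const_mul]
    refine circleIntegral.integral_congr hρ.le fun z hz => ?_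
    have hz0 : z ≠ 0 := hne z (by rwa [abs_of_pos hρ])
    simp only [zpow_sub₀ hz0, zpow_natCast, zpow_one, mul_pow, inv_pow]
    field_simp
  simp_rw [hterm]
  have hN : (∮ z in C(0, ρ), z ^ ((N : ℤ) - 1 - (N : ℕ))) = 2 * Real.pi * I := by
    have : (N : ℤ) - 1 - (N : ℕ) = -1 := by ring
    rw [this]
    simpa using circleIntegral.integral_sub_inv_of_mem_ball (c := 0) (w := 0) (R := ρ) (by simpa)
  have := hasSum_single (f := fun k : ℕ => (a ^ k / k !) * ∮ z in C(0, ρ), z ^ ((N : ℤ) - 1 - k)) N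
    (fun _ _ => by
      rw [circleIntegral_zpow_of_ne (by omega), mul_zero])
  rwa [hN, mul_comm] at this

lemma poissonWeight_nonneg (k : ℕ) {a : ℝ} (ha : 0 ≤ a) : 0 ≤ poissonWeight k a := by
  unfold poissonWeight; positivity

lemma hasSum_poissonWeight (a : ℝ) : HasSum (fun k => poissonWeight k a) 1 := by
  have h := (NormedSpace.exp_series_hasSum_exp' (𝕂 := ℝ) a).mul_left (Real.exp (-a))
  rw [← Real.exp_eq_exp_ℝ, ← Real.exp_add, neg_add_cancel, Real.exp_zero] at h
  refine h.congr_fun fun k => ?_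
  simp only [poissonWeight, smul_eq_mul]; ring

lemma hasSum_skellam_circleIntegral (m : ℕ) (a b : ℝ) {ρ : ℝ} (hρ : 0 < ρ) :
    HasSum (fun k : ℕ =>
        (2 * Real.pi * I * ((poissonWeight (k + m) a * poissonWeight k b : ℝ) : ℂ)))
      (∮ z in C(0, ρ), z ^ m * z⁻¹ * exp (b * z - b + (a * z⁻¹ - a))) := by
  have hne : ∀ z ∈ Metric.sphere (0 : ℂ) |ρ|, z ≠ 0 := fun z hz h => by
    simp [h, hρ.ne, abs_of_pos hρ] at hz
  have hinv : ContinuousOn (fun z : ℂ => z⁻¹) (Metric.sphere 0 |ρ|) :=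
    continuousOn_id.inv₀ hne
  have h := hasSum_circleIntegral_mul_exp (ρ := ρ)
    (F := fun z => z ^ m * z⁻¹ * exp (a * z⁻¹)) (g := fun z => b * z)
    (by fun_prop) (by fun_prop)
  have h2 := h.mul_left (exp (-a - b))
  rw [← circleIntegral.integral_const_mul] at h2
  have hfun : (∮ z in C(0, ρ), z ^ m * z⁻¹ * exp (b * z - b + (a * z⁻¹ - a))) =
      ∮ z in C(0, ρ), exp (-a - b) * (z ^ m * z⁻¹ * exp (a * z⁻¹) * exp (b * z)) := by
    congr 1
    funext z
    have : (b * z - b + (a * z⁻¹ - a) : ℂ) = (-a - b) + (a * z⁻¹ + b * z) := by ring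
    rw [this, exp_add, exp_add]
    ring
  rw [hfun]
  refine h2.congr_fun fun k => ?_
  · have : (∮ z in C(0, ρ), z ^ m * z⁻¹ * exp (a * z⁻¹) * ((b * z) ^ k / k !)) =
        (b ^ k / k !) * ∮ z in C(0, ρ), z ^ (k + m) * z⁻¹ * exp (a * z⁻¹) := by
      rw [← circleIntegral.integral_const_mul]
      congr 1; funext (z : ℂ); rw [pow_add]; ring
    rw [this, circleIntegral_pow_mul_exp_div hρ]
    simp only [poissonWeight]
    push_cast
    rw [sub_eq_add_neg, exp_add]
    ring

lemma summable_skellam (m : ℕ) (a b : ℝ) :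
    Summable fun k => poissonWeight (k + m) a * poissonWeight k b := by
  have h := (hasSum_skellam_circleIntegral m a b one_pos).mul_left (2 * Real.pi * I : ℂ)⁻¹
  have h2 := h.summable
  simp_rw [inv_mul_cancel_left₀ two_pi_I_ne_zero] at h2
  exact_mod_cast h2

/-- The Skellam kernel is a Laurent coefficient, extracted on a circle of any radius. -/
lemma circleIntegral_eq_skellam (m : ℕ) (a b : ℝ) {ρ : ℝ} (hρ : 0 < ρ) :
    (∮ z in C(0, ρ), z ^ m * z⁻¹ * exp (b * z - b + (a * z⁻¹ - a))) =
      2 * Real.pi * I * skellam m a b := by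
  refine (hasSum_skellam_circleIntegral m a b hρ).unique (HasSum.mul_left _ ?_)
  exact_mod_cast (summable_skellam m a b).hasSum

lemma skellam_nonneg (m : ℕ) {a b : ℝ} (ha : 0 ≤ a) (hb : 0 ≤ b) : 0 ≤ skellam m a b :=
  tsum_nonneg fun _ => mul_nonneg (poissonWeight_nonneg _ ha) (poissonWeight_nonneg _ hb)

/-- The Fourier representation of the Skellam kernel, from the unit circle. -/
lemma skellam_eq_integral (m : ℕ) (a b : ℝ) :
    (skellam m a b : ℂ) = (((2 * Real.pi)⁻¹ : ℝ) : ℂ) * ∫ θ in (-Real.pi)..Real.pi,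
      exp (((-(a + b) * (1 - Real.cos θ) : ℝ) : ℂ) +
        ((m * θ + (b - a) * Real.sin θ : ℝ) : ℂ) * I) := by
  have h := circleIntegral_eq_skellam m a b one_pos
  set G : ℝ → ℂ := fun θ => exp (((-(a + b) * (1 - Real.cos θ) : ℝ) : ℂ) +
        ((m * θ + (b - a) * Real.sin θ : ℝ) : ℂ) * I) with hG
  have hint : (∮ z in C(0, 1), z ^ m * z⁻¹ * exp (b * z - b + (a * z⁻¹ - a))) =
      I * ∫ θ in (0 : ℝ)..2 * Real.pi, G θ := by
    rw [circleIntegral, ← intervalIntegral.integral_const_mul]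
    congr 1; ext θ
    have hz : circleMap 0 1 θ = exp (θ * I) := by simp [circleMap]
    have hz2 : (exp (θ * I))⁻¹ = exp (-θ * I) := by rw [← exp_neg]; ring_nf
    have e1 : exp (θ * I) = cos θ + sin θ * I := exp_mul_I _
    have e2 : exp (-θ * I) = cos θ - sin θ * I := by
      rw [exp_mul_I, cos_neg, sin_neg]; ring
    rw [deriv_circleMap, hz, smul_eq_mul, hz2, hG]
    have e3 : exp (θ * I) * I * (exp (θ * I) ^ m * exp (-θ * I) *
        exp (b * exp (θ * I) - b + (a * exp (-θ * I) - a))) =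
        I * (exp (θ * I) * exp (-θ * I)) * (exp (m * (θ * I)) *
          exp (b * exp (θ * I) - b + (a * exp (-θ * I) - a))) := by
      rw [exp_nat_mul]; ring
    rw [e3, ← exp_add, ← exp_add, e1, e2]
    simp only [neg_mul, add_neg_cancel, exp_zero, mul_one]
    push_cast
    congr 2; ring
  have hper : Function.Periodic G (2 * Real.pi) := by
    intro θ
    simp only [hG, Real.cos_add_two_pi, Real.sin_add_two_pi]
    rw [exp_eq_exp_iff_exists_int]
    exact ⟨m, by push_cast; ring⟩
  have hshift := hper.intervalIntegral_add_eq 0 (-Real.pi)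
  rw [zero_add, show -Real.pi + 2 * Real.pi = Real.pi by ring] at hshift
  rw [hint, hshift] at h
  have hpi : (Real.pi : ℂ) ≠ 0 := by exact_mod_cast Real.pi_ne_zero
  have : I * (∫ θ in (-Real.pi)..Real.pi, G θ) = I * (2 * Real.pi * skellam m a b) := by
    rw [h]; ring
  have := mul_left_cancel₀ I_ne_zero this
  rw [this]; push_cast; field_simp

/-- Continuity is read off the Fourier representation, not off the series. -/
lemma continuous_skellam (m : ℕ) : Continuous fun p : ℝ × ℝ => skellam m p.1 p.2 := by
  have h : Continuous fun p : ℝ × ℝ => (skellam m p.1 p.2 : ℂ) := by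
    simp_rw [skellam_eq_integral]
    refine continuous_const.mul ?_
    refine intervalIntegral.continuous_parametric_intervalIntegral_of_continuous' ?_ _ _
    fun_prop
  exact Complex.continuous_re.comp h

lemma integral_poissonWeight_le (k : ℕ) (T : ℝ) :
    ∫ b in Ioc 0 T, poissonWeight k b ≤ 1 := by
  have hg : ∫ b in Ioi (0 : ℝ), poissonWeight k b = 1 := by
    have := Real.Gamma_nat_eq_factorial k
    rw [Real.Gamma_eq_integral (by positivity)] at this
    simp only [add_sub_cancel_right, Real.rpow_natCast] at this
    simp only [poissonWeight]
    rw [integral_div, this, div_self (by positivity)]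
  rw [← hg]
  refine setIntegral_mono_set ?_ ?_ ?_
  · by_contra hni
    rw [integral_undef hni] at hg
    exact zero_ne_one hg
  · filter_upwards [ae_restrict_mem measurableSet_Ioi] with b hb
    exact poissonWeight_nonneg k (le_of_lt hb)
  · exact Ioc_subset_Ioi_self.eventuallyLE

/-- The Skellam kernel is a subprobability density in its second argument. -/
lemma integral_skellam_le (m : ℕ) {a : ℝ} (ha : 0 ≤ a) (T : ℝ) :
    ∫ b in Ioc 0 T, skellam m a b ≤ 1 := by
  have hcont : ∀ k, Continuous (poissonWeight k) := fun k => by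
    unfold poissonWeight; fun_prop
  have hw : Summable fun k => poissonWeight (k + m) a :=
    (summable_nat_add_iff m).2 (hasSum_poissonWeight a).summable
  have hnn : ∀ k, 0 ≤ ∫ b in Ioc 0 T, poissonWeight k b := fun k =>
    setIntegral_nonneg measurableSet_Ioc fun b hb => poissonWeight_nonneg k hb.1.le
  have hle : ∀ k, ∫ b in Ioc 0 T, poissonWeight (k + m) a * poissonWeight k b ≤
      poissonWeight (k + m) a := fun k => by
    rw [integral_const_mul]
    exact mul_le_of_le_one_right (poissonWeight_nonneg _ ha) (integral_poissonWeight_le k T)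
  have hnorm : ∀ k, ∫ b in Ioc 0 T, ‖poissonWeight (k + m) a * poissonWeight k b‖ =
      ∫ b in Ioc 0 T, poissonWeight (k + m) a * poissonWeight k b := fun k =>
    setIntegral_congr_fun measurableSet_Ioc fun b hb =>
      Real.norm_of_nonneg (mul_nonneg (poissonWeight_nonneg _ ha)
        (poissonWeight_nonneg _ hb.1.le))
  have hsum : Summable fun k => ∫ b in Ioc 0 T, poissonWeight (k + m) a * poissonWeight k b := by
    refine hw.of_nonneg_of_le (fun k => ?_) hle
    rw [integral_const_mul]
    exact mul_nonneg (poissonWeight_nonneg _ ha) (hnn k)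
  have hs := hasSum_integral_of_summable_integral_norm (μ := volume.restrict (Ioc 0 T))
    (F := fun k b => poissonWeight (k + m) a * poissonWeight k b)
    (fun k => (((hcont k).const_mul _).integrableOn_Icc).mono_set Ioc_subset_Icc_self)
    (by simpa only [hnorm] using hsum)
  change ∫ b in Ioc 0 T, ∑' k, poissonWeight (k + m) a * poissonWeight k b ≤ 1
  rw [← hs.tsum_eq]
  refine (hsum.tsum_le_tsum hle hw).trans ?_
  refine (hw.tsum_le_of_sum_le fun s => ?_)
  have hmap := Finset.sum_map s (addRightEmbedding m) (fun k => poissonWeight k a)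
  simp only [addRightEmbedding_apply] at hmap
  rw [← hmap]
  exact sum_le_hasSum _ (fun _ _ => poissonWeight_nonneg _ ha) (hasSum_poissonWeight a)

/-- A Gaussian bound for the exponent in the Fourier representation. -/
lemma neg_mul_one_sub_cos_le {A θ : ℝ} (hA : 0 ≤ A) (hθ : |θ| ≤ Real.pi) :
    -A * (1 - Real.cos θ) ≤ -(2 * A / Real.pi ^ 2) * θ ^ 2 := by
  have h := mul_le_mul_of_nonneg_left (Real.cos_le_one_sub_mul_cos_sq hθ) hA
  have : -(2 * A / Real.pi ^ 2) * θ ^ 2 = -(A * (2 / Real.pi ^ 2 * θ ^ 2)) := by ring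
  rw [this]; linarith

/-- A bound that is uniform in `a` and `m`, which makes it pass to the iterated kernels. -/
lemma skellam_le_inv_sqrt (m : ℕ) {a b : ℝ} (ha : 0 ≤ a) (hb : 0 < b) :
    skellam m a b ≤ 1 / √b := by
  have hpi := Real.pi_pos
  have hA : 0 < 2 * b / Real.pi ^ 2 := by positivity
  have h1 : ‖(skellam m a b : ℂ)‖ ≤
      (2 * Real.pi)⁻¹ * ∫ θ : ℝ, Real.exp (-(2 * b / Real.pi ^ 2) * θ ^ 2) := by
    rw [skellam_eq_integral, norm_mul]
    rw [norm_real, Real.norm_of_nonneg (by positivity)]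
    gcongr
    refine (intervalIntegral.norm_integral_le_integral_norm (by linarith)).trans ?_
    rw [intervalIntegral.integral_of_le (by linarith)]
    refine (setIntegral_mono_on (g := fun θ => Real.exp (-(2 * b / Real.pi ^ 2) * θ ^ 2))
      ?_ (integrable_exp_neg_mul_sq hA).integrableOn
      measurableSet_Ioc ?_).trans (setIntegral_le_integral (integrable_exp_neg_mul_sq hA)
        (.of_forall fun θ => (Real.exp_pos _).le))
    · refine (Continuous.integrableOn_Icc ?_).mono_set Ioc_subset_Icc_self
      fun_prop
    · intro θ hθ
      rw [norm_exp]
      have hre : ((((-(a + b) * (1 - Real.cos θ) : ℝ) : ℂ) +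
        ((m * θ + (b - a) * Real.sin θ : ℝ) : ℂ) * I)).re = -(a + b) * (1 - Real.cos θ) := by
        rw [add_re, re_ofReal_mul, I_re, ofReal_re, mul_zero, add_zero]
      rw [hre]
      refine Real.exp_le_exp.2 ((?_ : _ ≤ -b * (1 - Real.cos θ)).trans
        (neg_mul_one_sub_cos_le hb.le (abs_le.2 ⟨hθ.1.le, hθ.2⟩)))
      have := Real.cos_le_one θ
      nlinarith
  rw [integral_gaussian, norm_real] at h1
  refine (le_abs_self _).trans (h1.trans ?_)
  rw [show Real.pi / (2 * b / Real.pi ^ 2) = (Real.pi / 2) * (Real.pi ^ 2 / b) by field_simp,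
    Real.sqrt_mul (by positivity), Real.sqrt_div (sq_nonneg _), Real.sqrt_sq hpi.le]
  have h2 : √(Real.pi / 2) ≤ 2 := by
    rw [Real.sqrt_le_left (by norm_num)]; linarith [Real.pi_le_four]
  have hb' : 0 < √b := Real.sqrt_pos.2 hb
  calc (2 * Real.pi)⁻¹ * (√(Real.pi / 2) * (Real.pi / √b))
      ≤ (2 * Real.pi)⁻¹ * (2 * (Real.pi / √b)) := by gcongr
    _ = 1 / √b := by field_simp

/-! ### Torus integrals that vanish by Cauchy's theorem in one variable -/

lemma norm_torusMap_apply {n : ℕ} {r : ℝ} (hr : 0 ≤ r) (θ : Fin n → ℝ) (j : Fin n) :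
    ‖torusMap (fun _ => (0 : ℂ)) (fun _ => r) θ j‖ = r := by
  simp [torusMap, abs_of_nonneg hr]

lemma continuous_torusMap {n : ℕ} (c : Fin n → ℂ) (R : Fin n → ℝ) :
    Continuous (torusMap c R) := by
  unfold torusMap; fun_prop

lemma torusIntegrable_of_continuousOn {n : ℕ} {f : (Fin n → ℂ) → ℂ} {r : ℝ} (hr : 0 ≤ r)
    (hf : ContinuousOn f {z | ∀ j, ‖z j‖ = r}) :
    TorusIntegrable f (fun _ => 0) (fun _ => r) := by
  have : Continuous fun θ => f (torusMap (fun _ => (0 : ℂ)) (fun _ => r) θ) :=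
    hf.comp_continuous (continuous_torusMap _ _) fun θ j => norm_torusMap_apply hr θ j
  exact this.continuousOn.integrableOn_compact isCompact_Icc

/-- If the integrand is holomorphic in one of the variables, up to the interior of its circle,
then the torus integral vanishes. -/
lemma torusIntegral_eq_zero_of_differentiableAt {N : ℕ} {f : (Fin (N + 1) → ℂ) → ℂ} {r : ℝ}
    (hr : 0 ≤ r) (hf : TorusIntegrable f (fun _ => 0) (fun _ => r)) (i : Fin (N + 1))
    (h : ∀ y : Fin N → ℂ, (∀ j, ‖y j‖ = r) → ∀ z ∈ Metric.closedBall (0 : ℂ) r,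
      DifferentiableAt ℂ (fun z => f (i.insertNth z y)) z) :
    torusIntegral f (fun _ => 0) (fun _ => r) = 0 := by
  set e : ℝ × (Fin N → ℝ) ≃ᵐ (Fin (N + 1) → ℝ) :=
    (MeasurableEquiv.piFinSuccAbove (fun _ => ℝ) i).symm with he
  have hem : MeasurePreserving e :=
    (volume_preserving_piFinSuccAbove (fun _ : Fin (N + 1) => ℝ) i).symm _
  have heπ : (e ⁻¹' Icc 0 fun _ => 2 * Real.pi) =
      Icc 0 (2 * Real.pi) ×ˢ Icc (0 : Fin N → ℝ) fun _ => 2 * Real.pi :=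
    ((Fin.insertNthOrderIso (fun _ => ℝ) i).preimage_Icc _ _).trans (Icc_prod_eq _ _)
  have hint := hf.function_integrable
  rw [← hem.integrableOn_comp_preimage e.measurableEmbedding, heπ] at hint
  rw [torusIntegral, ← hem.map_eq, setIntegral_map_equiv, heπ]
  rw [IntegrableOn, Measure.volume_eq_prod, ← Measure.prod_restrict, Function.comp_def] at hint
  rw [Measure.volume_eq_prod, ← Measure.prod_restrict, integral_prod_symm _ hint]
  refine integral_eq_zero_of_ae (.of_forall fun Θ => ?_)
  -- with the other variables frozen, the inner integral is a circle integral
  set y := torusMap (fun _ => (0 : ℂ)) (fun _ => r) Θ with hy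
  have hc : (∮ z in C(0, r), f (i.insertNth z y)) = 0 := by
    have hd := h y (fun j => norm_torusMap_apply hr Θ j)
    exact circleIntegral_eq_zero_of_differentiable_on_off_countable hr countable_empty
      (fun z hz => (hd z hz).continuousAt.continuousWithinAt)
      (fun z hz => hd z (Metric.ball_subset_closedBall hz.1))
  have key : ∀ θ : ℝ, ((∏ j, (r : ℂ) * exp (e (θ, Θ) j * I) * I) •
      f (torusMap (fun _ => 0) (fun _ => r) (e (θ, Θ)))) =
      (∏ j, (r : ℂ) * exp (Θ j * I) * I) * (deriv (circleMap 0 r) θ •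
        f (i.insertNth (circleMap 0 r θ) y)) := by
    intro θ
    have hins : (e (θ, Θ)) = i.insertNth θ Θ := by
      simp [he, MeasurableEquiv.piFinSuccAbove_symm_apply, Fin.insertNthEquiv]
    have hmap : torusMap (fun _ => (0 : ℂ)) (fun _ => r) (i.insertNth θ Θ : Fin (N + 1) → ℝ) =
        i.insertNth (circleMap 0 r θ) y := by
      ext j
      refine Fin.succAboveCases i ?_ (fun k => ?_) j
      · simp [torusMap, circleMap]
      · simp [torusMap, hy]
    rw [hins, hmap, i.prod_univ_succAbove]
    simp only [Fin.insertNth_apply_same, Fin.insertNth_apply_succAbove, deriv_circleMap,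
      smul_eq_mul, circleMap, zero_add]
    ring
  simp only [Pi.zero_apply, key]
  rw [integral_const_mul]
  rw [circleIntegral_def_Icc] at hc
  rw [hc, mul_zero]

/-! ### Removing the poles of the kernel -/

/-- The denominator of the kernel. -/
def den (z w : ℂ) : ℂ := z * w + 1 - 2 * w

/-- The kernel `K_{x,t}` conjugated by `z ↦ exp (t / z)`. -/
noncomputable def twistedKernel (m : ℕ) (t : ℝ) (z w : ℂ) : ℂ :=
  z ^ m * exp (t * den z w / w) / den z w

/-- The conjugated kernel minus its value at `t = 0`. The zeros of the denominator are removable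
singularities of this expression; the value `0` that division assigns there plays no role, since
the denominator does not vanish on the torus. -/
noncomputable def regularKernel (m : ℕ) (t : ℝ) (z w : ℂ) : ℂ :=
  z ^ m * (exp (t * den z w / w) - 1) / den z w

/-- The second summand carries the pole; it is the conjugated kernel at `t = 0`. -/
lemma twistedKernel_eq (m : ℕ) (t : ℝ) (z w : ℂ) :
    twistedKernel m t z w = regularKernel m t z w + z ^ m / den z w := by
  unfold twistedKernel regularKernel; ring

lemma kernel_mul_exp_div (x : ℤ) (t : ℝ) {z w : ℂ} (hz : z ≠ 0) (hw : w ≠ 0) :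
    kernel x t z w * exp (t / w) / exp (t / z) = twistedKernel x.natAbs t z w := by
  have h : eps z * t + t / w - t / z = t * den z w / w := by
    unfold eps den; field_simp; ring
  rw [twistedKernel, ← h, exp_sub, exp_add, kernel, den]
  ring

/-- Conjugation does not change cyclic products. -/
lemma prod_kernel_eq_prod_twistedKernel {n : ℕ} (x : ℤ) (t : ℝ) {z : Fin n → ℂ}
    (hz : ∀ j, z j ≠ 0) :
    ∏ j, kernel x t (z j) (z (finRotate n j)) =
      ∏ j, twistedKernel x.natAbs t (z j) (z (finRotate n j)) := by
  have h : ∏ j, exp (t / z (finRotate n j)) = ∏ j, exp (t / z j) :=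
    Equiv.prod_comp (finRotate n) fun j => exp (t / z j)
  simp_rw [← fun j => kernel_mul_exp_div x t (z := z j) (hz j) (hz (finRotate n j))]
  rw [Finset.prod_div_distrib, Finset.prod_mul_distrib, h, mul_div_cancel_right₀]
  exact Finset.prod_ne_zero_iff.2 fun j _ => exp_ne_zero _

lemma IsSmallRadius.den_ne_zero {r : ℝ} (hr : IsSmallRadius r) {z w : ℂ} (hz : ‖z‖ ≤ r)
    (hw : ‖w‖ ≤ r) : den z w ≠ 0 := hr.2 z w hz hw

lemma continuousOn_prod_kernels {N m : ℕ} {t r : ℝ} (hr : IsSmallRadius r)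
    (s : Finset (Fin (N + 1))) (u : Finset (Fin (N + 1))) :
    ContinuousOn (fun z : Fin (N + 1) → ℂ => ∏ j ∈ u,
      (if j ∈ s then regularKernel m t (z j) (z (finRotate _ j))
        else twistedKernel m t (z j) (z (finRotate _ j)))) {z | ∀ j, ‖z j‖ = r} := by
  have hap : ∀ j, ContinuousOn (fun z : Fin (N + 1) → ℂ => z j) {z | ∀ j, ‖z j‖ = r} :=
    fun j => (continuous_apply j).continuousOn
  have hden : ∀ j, ContinuousOn (fun z : Fin (N + 1) → ℂ => den (z j) (z (finRotate _ j)))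
      {z | ∀ j, ‖z j‖ = r} := fun j => by unfold den; fun_prop
  have hd0 : ∀ j, ∀ z ∈ {z : Fin (N + 1) → ℂ | ∀ j, ‖z j‖ = r},
      den (z j) (z (finRotate _ j)) ≠ 0 :=
    fun j z hz => hr.den_ne_zero (hz j).le (hz _).le
  have hz0 : ∀ j, ∀ z ∈ {z : Fin (N + 1) → ℂ | ∀ j, ‖z j‖ = r}, z j ≠ 0 :=
    fun j z hz => norm_pos_iff.1 (by rw [hz j]; exact hr.1)
  have hexp : ∀ j, ContinuousOn (fun z : Fin (N + 1) → ℂ =>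
      exp (t * den (z j) (z (finRotate _ j)) / z (finRotate _ j))) {z | ∀ j, ‖z j‖ = r} :=
    fun j => ((continuousOn_const.mul (hden j)).div (hap _) (hz0 _)).cexp
  refine continuousOn_finsetProd _ fun j _ => ?_
  split_ifs
  · exact (((hap j).pow m).mul ((hexp j).sub continuousOn_const)).div (hden j) (hd0 j)
  · exact (((hap j).pow m).mul (hexp j)).div (hden j) (hd0 j)

/-- A cyclic product in which at least one factor is the time-zero kernel `z ^ m / den z w`
integrates to zero: it is holomorphic in the second variable of that factor. -/
lemma torusIntegral_prod_eq_zero {N m : ℕ} {t r : ℝ} (hr : IsSmallRadius r)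
    (s : Finset (Fin (N + 1))) (a : Fin (N + 1)) :
    torusIntegral (fun z : Fin (N + 1) → ℂ =>
      (z a ^ m / den (z a) (z (finRotate _ a))) * ∏ j ∈ Finset.univ.erase a,
        (if j ∈ s then regularKernel m t (z j) (z (finRotate _ j))
          else twistedKernel m t (z j) (z (finRotate _ j))))
      (fun _ => 0) (fun _ => r) = 0 := by
  have hr0 := hr.1
  refine torusIntegral_eq_zero_of_differentiableAt hr0.le
    (torusIntegrable_of_continuousOn hr0.le ?_) (finRotate _ a) ?_
  · refine ContinuousOn.mul (ContinuousOn.div ?_ ?_ fun z hz => hr.den_ne_zero (hz a).le (hz _).le)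
      (continuousOn_prod_kernels hr _ _)
    · fun_prop
    · unfold den; fun_prop
  · intro y hy z hz
    set b := finRotate (N + 1) a with hb
    have hcoord : ∀ j, DifferentiableAt ℂ
        (fun z => (b.insertNth z y : Fin (N + 1) → ℂ) j) z := fun j => by
      refine Fin.succAboveCases b ?_ (fun k => ?_) j
      · simp
      · simp
    have hnorm : ∀ j, ‖(b.insertNth z y : Fin (N + 1) → ℂ) j‖ ≤ r := fun j => by
      refine Fin.succAboveCases b ?_ (fun k => ?_) j
      · simpa using hz
      · simpa using (hy k).le
    have hden : ∀ j, DifferentiableAt ℂ (fun z => den ((b.insertNth z y : Fin (N + 1) → ℂ) j)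
        ((b.insertNth z y : Fin (N + 1) → ℂ) (finRotate _ j))) z := fun j => by
      have h1 := hcoord j
      have h2 := hcoord (finRotate _ j)
      unfold den; fun_prop
    have hd0 : ∀ j, den ((b.insertNth z y : Fin (N + 1) → ℂ) j)
        ((b.insertNth z y : Fin (N + 1) → ℂ) (finRotate _ j)) ≠ 0 :=
      fun j => hr.den_ne_zero (hnorm _) (hnorm _)
    refine (((hcoord a).pow m).div (hden a) (hd0 a)).mul
      (DifferentiableAt.fun_finsetProd fun j hj => ?_)
    have hjb : finRotate (N + 1) j ≠ b := fun h =>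
      (Finset.mem_erase.1 hj).1 ((finRotate (N + 1)).injective (h.trans hb))
    obtain ⟨k, hk⟩ := Fin.exists_succAbove_eq hjb
    -- the second variable of every other factor is frozen on the circle, away from `0`
    have hne : (b.insertNth z y : Fin (N + 1) → ℂ) (finRotate _ j) ≠ 0 := by
      rw [← hk, Fin.insertNth_apply_succAbove]
      exact norm_pos_iff.1 (by rw [hy k]; exact hr0)
    have hexp : DifferentiableAt ℂ (fun z => exp (t * den ((b.insertNth z y : Fin (N + 1) → ℂ) j)
        ((b.insertNth z y : Fin (N + 1) → ℂ) (finRotate _ j)) /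
          (b.insertNth z y : Fin (N + 1) → ℂ) (finRotate _ j))) z :=
      (((hden j).const_mul _).div (hcoord _) hne).cexp
    split_ifs
    · exact (((hcoord j).pow m).mul (hexp.sub_const 1)).div (hden j) (hd0 j)
    · exact (((hcoord j).pow m).mul hexp).div (hden j) (hd0 j)

/-- The poles of the conjugated kernel do not contribute to the trace: its factors may be replaced
by regular ones, one at a time. -/
lemma torusIntegral_prod_twistedKernel_eq {N m : ℕ} {t r : ℝ} (hr : IsSmallRadius r)
    (s : Finset (Fin (N + 1))) :
    torusIntegral (fun z : Fin (N + 1) → ℂ => ∏ j,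
      (if j ∈ s then regularKernel m t (z j) (z (finRotate _ j))
        else twistedKernel m t (z j) (z (finRotate _ j)))) (fun _ => 0) (fun _ => r) =
    torusIntegral (fun z : Fin (N + 1) → ℂ =>
      ∏ j, twistedKernel m t (z j) (z (finRotate _ j))) (fun _ => 0) (fun _ => r) := by
  induction s using Finset.induction_on with
  | empty => simp
  | insert a s ha ih =>
    rw [← ih, ← sub_eq_zero, ← torusIntegral_sub
      (torusIntegrable_of_continuousOn hr.1.le (continuousOn_prod_kernels hr _ _))
      (torusIntegrable_of_continuousOn hr.1.le (continuousOn_prod_kernels hr _ _)),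
      ← neg_eq_zero, ← torusIntegral_neg]
    refine Eq.trans ?_ (torusIntegral_prod_eq_zero (m := m) (t := t) hr s a)
    congr 1
    funext z
    rw [← Finset.mul_prod_erase _ _ (Finset.mem_univ a),
      ← Finset.mul_prod_erase _ _ (Finset.mem_univ a), if_pos (Finset.mem_insert_self a s),
      if_neg ha, twistedKernel_eq]
    have : ∀ j ∈ Finset.univ.erase a,
        (if j ∈ insert a s then regularKernel m t (z j) (z (finRotate _ j))
          else twistedKernel m t (z j) (z (finRotate _ j))) =
        (if j ∈ s then regularKernel m t (z j) (z (finRotate _ j))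
          else twistedKernel m t (z j) (z (finRotate _ j))) := fun j hj => by
      simp only [Finset.mem_insert, Finset.ne_of_mem_erase hj, false_or]
    rw [Finset.prod_congr rfl this]
    ring

/-! ### The trace as an integral over a cube -/

lemma pi_restrict_Icc (n : ℕ) (a b : ℝ) :
    Measure.pi (fun _ : Fin n => (volume : Measure ℝ).restrict (Icc a b)) =
      (volume : Measure (Fin n → ℝ)).restrict (Icc (fun _ => a) fun _ => b) := by
  rw [← Set.pi_univ_Icc, volume_pi, Measure.restrict_pi_pi]

lemma integrable_pi_of_continuous {n : ℕ} {F : (Fin n → ℝ) → ℝ} (hF : Continuous F) (T : ℝ) :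
    Integrable F (Measure.pi fun _ => (volume : Measure ℝ).restrict (Ioc 0 T)) := by
  rw [Measure.restrict_congr_set Ioc_ae_eq_Icc, pi_restrict_Icc]
  exact hF.continuousOn.integrableOn_compact isCompact_Icc

lemma integrable_pi_prod_of_continuous {n : ℕ} {F : (Fin n → ℝ) × (Fin n → ℝ) → ℂ}
    (hF : Continuous F) (T U : ℝ) :
    Integrable F ((Measure.pi fun _ => (volume : Measure ℝ).restrict (Icc 0 T)).prod
      (Measure.pi fun _ => (volume : Measure ℝ).restrict (Ioc 0 U))) := by
  rw [Measure.restrict_congr_set Ioc_ae_eq_Icc, pi_restrict_Icc, pi_restrict_Icc,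
    Measure.prod_restrict]
  exact hF.continuousOn.integrableOn_compact (isCompact_Icc.prod isCompact_Icc)

/-- The regular kernel factorizes over an additional integration variable. -/
lemma regularKernel_eq_integral (m : ℕ) {t : ℝ} (ht : 0 ≤ t) {z w : ℂ} (hw : w ≠ 0)
    (hd : den z w ≠ 0) :
    regularKernel m t z w = ∫ s in Ioc 0 t,
      (z ^ m * exp (s * z - s)) * (exp (s * w⁻¹ - s) * w⁻¹) := by
  have hc : den z w / w ≠ 0 := div_ne_zero hd hw
  have h : ∀ s : ℝ, (z ^ m * exp (s * z - s)) * (exp (s * w⁻¹ - s) * w⁻¹) =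
      z ^ m * w⁻¹ * exp (den z w / w * s) := fun s => by
    have : den z w / w * s = (s * z - s) + (s * w⁻¹ - s) := by
      unfold den; field_simp; ring
    rw [this, exp_add]; ring
  simp_rw [h]
  rw [← intervalIntegral.integral_of_le ht, intervalIntegral.integral_const_mul,
    integral_exp_mul_complex hc, regularKernel]
  simp only [ofReal_zero, mul_zero, exp_zero]
  rw [show den z w / w * t = t * den z w / w by ring]
  field_simp

/-- The trace is the integral over a cube of a cyclic product of Skellam kernels. -/
lemma traceI_eq_integral {r : ℝ} (hr : IsSmallRadius r) (N : ℕ) (x : ℤ) {t : ℝ} (ht : 0 ≤ t) :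
    traceI r (N + 1) x t = ((∫ σ : Fin (N + 1) → ℝ,
      ∏ j, skellam x.natAbs (σ j) (σ (finRotate _ j))
        ∂Measure.pi fun _ => (volume : Measure ℝ).restrict (Ioc 0 t) : ℝ) : ℂ) := by
  set m := x.natAbs with hm
  have hr0 := hr.1
  have hnorm : ∀ (θ : Fin (N + 1) → ℝ) j, ‖torusMap (fun _ => (0 : ℂ)) (fun _ => r) θ j‖ = r :=
    fun θ j => norm_torusMap_apply hr0.le θ j
  have hne : ∀ (θ : Fin (N + 1) → ℝ) j, torusMap (fun _ => (0 : ℂ)) (fun _ => r) θ j ≠ 0 :=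
    fun θ j => norm_pos_iff.1 (by rw [hnorm]; exact hr0)
  have h1 : torusIntegral (fun z : Fin (N + 1) → ℂ => ∏ j, kernel x t (z j) (z (finRotate _ j)))
      (fun _ => 0) (fun _ => r) = torusIntegral (fun z : Fin (N + 1) → ℂ =>
        ∏ j, regularKernel m t (z j) (z (finRotate _ j))) (fun _ => 0) (fun _ => r) := by
    have h2 := torusIntegral_prod_twistedKernel_eq (m := m) (t := t) hr
      (Finset.univ : Finset (Fin (N + 1)))
    simp only [Finset.mem_univ, if_true] at h2
    rw [h2]
    unfold torusIntegral
    congr 1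
    funext θ
    beta_reduce
    rw [prod_kernel_eq_prod_twistedKernel x t (hne θ)]
  -- each factor of the regular kernels, with the line element absorbed into the first one
  set A : ℝ → ℝ → ℂ := fun θ s => deriv (circleMap 0 r) θ *
    (circleMap 0 r θ ^ m * exp (s * circleMap 0 r θ - s)) with hA
  set B : ℝ → ℝ → ℂ := fun θ s =>
    exp (s * (circleMap 0 r θ)⁻¹ - s) * (circleMap 0 r θ)⁻¹ with hB
  have hcne : ∀ θ, circleMap 0 r θ ≠ 0 := fun θ => by simp [hr0.ne']
  have hAc : Continuous fun p : ℝ × ℝ => A p.1 p.2 := by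
    have := continuous_circleMap (0 : ℂ) r
    simp only [hA, deriv_circleMap]; fun_prop
  have hBc : Continuous fun p : ℝ × ℝ => B p.1 p.2 := by
    have h1 : Continuous fun p : ℝ × ℝ => (circleMap 0 r p.1)⁻¹ :=
      ((continuous_circleMap (0 : ℂ) r).comp continuous_fst).inv₀ fun p => hcne p.1
    simp only [hB]; fun_prop
  have h3 : torusIntegral (fun z : Fin (N + 1) → ℂ =>
        ∏ j, regularKernel m t (z j) (z (finRotate _ j))) (fun _ => 0) (fun _ => r) =
      ∫ θ : Fin (N + 1) → ℝ, (∫ σ : Fin (N + 1) → ℝ,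
        ∏ j, A (θ j) (σ j) * B (θ (finRotate _ j)) (σ j)
          ∂Measure.pi fun _ => (volume : Measure ℝ).restrict (Ioc 0 t))
          ∂Measure.pi fun _ => (volume : Measure ℝ).restrict (Icc 0 (2 * Real.pi)) := by
    rw [pi_restrict_Icc, torusIntegral]
    congr 1
    funext θ
    have hmap : ∀ j, torusMap (fun _ => (0 : ℂ)) (fun _ => r) θ j = circleMap 0 r (θ j) :=
      fun j => by simp [torusMap, circleMap]
    rw [integral_fintype_prod_eq_prod (f := fun j s => A (θ j) s * B (θ (finRotate _ j)) s),
      smul_eq_mul, ← Finset.prod_mul_distrib]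
    refine Finset.prod_congr rfl fun j _ => ?_
    rw [regularKernel_eq_integral m ht (hne θ _)
      (hr.den_ne_zero (hnorm θ _).le (hnorm θ _).le), ← integral_const_mul]
    simp only [hmap, hA, hB, deriv_circleMap, circleMap, zero_add, mul_assoc]
  have h4 : ∀ σ : Fin (N + 1) → ℝ, (∫ θ : Fin (N + 1) → ℝ,
        ∏ j, A (θ j) (σ j) * B (θ (finRotate _ j)) (σ j)
          ∂Measure.pi fun _ => (volume : Measure ℝ).restrict (Icc 0 (2 * Real.pi))) =
      (2 * Real.pi * I) ^ (N + 1) *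
        ((∏ j, skellam m (σ j) (σ (finRotate _ j)) : ℝ) : ℂ) := fun σ => by
    -- collect the two factors that depend on the same angle
    have h5 : ∀ θ : Fin (N + 1) → ℝ, ∏ j, A (θ j) (σ j) * B (θ (finRotate _ j)) (σ j) =
        ∏ j, A (θ j) (σ j) * B (θ j) (σ ((finRotate _).symm j)) := fun θ => by
      rw [Finset.prod_mul_distrib (f := fun j => A (θ j) (σ j)),
        Finset.prod_mul_distrib (f := fun j => A (θ j) (σ j))]
      congr 1
      rw [← Equiv.prod_comp (finRotate (N + 1))
        fun j => B (θ j) (σ ((finRotate _).symm j))]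
      simp
    simp_rw [h5]
    rw [integral_fintype_prod_eq_prod
      (f := fun j θ => A θ (σ j) * B θ (σ ((finRotate _).symm j)))]
    have h6 : ∀ j, (∫ θ in Icc 0 (2 * Real.pi), A θ (σ j) * B θ (σ ((finRotate _).symm j))) =
        2 * Real.pi * I * skellam m (σ ((finRotate _).symm j)) (σ j) := fun j => by
      rw [← circleIntegral_eq_skellam m _ _ hr0, circleIntegral_def_Icc]
      congr 1
      funext θ
      simp only [hA, hB, smul_eq_mul, exp_add]
      ring
    simp_rw [h6]
    rw [Finset.prod_mul_distrib, Finset.prod_const, Finset.card_univ, Fintype.card_fin]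
    congr 1
    rw [← Equiv.prod_comp (finRotate (N + 1))]
    push_cast
    simp
  rw [traceI, h1, h3, integral_integral_swap]
  · simp_rw [h4]
    rw [integral_const_mul, integral_complex_ofReal, ← mul_assoc, ← mul_pow,
      inv_mul_cancel₀ two_pi_I_ne_zero, one_pow, one_mul]
  · refine integrable_pi_prod_of_continuous
      (F := fun p => ∏ j, A (p.1 j) (p.2 j) * B (p.1 (finRotate _ j)) (p.2 j)) ?_ _ _
    refine continuous_finsetProd _ fun j _ => ?_
    exact (hAc.comp (f := fun p : (Fin (N + 1) → ℝ) × (Fin (N + 1) → ℝ) => (p.1 j, p.2 j))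
      (by fun_prop)).mul (hBc.comp
        (f := fun p : (Fin (N + 1) → ℝ) × (Fin (N + 1) → ℝ) => (p.1 (finRotate _ j), p.2 j))
      (by fun_prop))

/-! ### Iterated kernels -/

/-- The kernel of the `(k + 1)`-st power of the Skellam kernel restricted to `[0, T]`. -/
noncomputable def iterKernel (m : ℕ) (T : ℝ) : ℕ → ℝ → ℝ → ℝ
  | 0, a, b => skellam m a b
  | k + 1, a, b => ∫ c in (0 : ℝ)..T, skellam m a c * iterKernel m T k c b

lemma continuous_iterKernel (m : ℕ) (T : ℝ) (k : ℕ) :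
    Continuous fun p : ℝ × ℝ => iterKernel m T k p.1 p.2 := by
  induction k with
  | zero => exact continuous_skellam m
  | succ k ih =>
    refine intervalIntegral.continuous_parametric_intervalIntegral_of_continuous' ?_ _ _
    exact ((continuous_skellam m).comp
      (f := fun q : (ℝ × ℝ) × ℝ => (q.1.1, q.2)) (by fun_prop)).mul
      (ih.comp (f := fun q : (ℝ × ℝ) × ℝ => (q.2, q.1.2)) (by fun_prop))

lemma integral_pi_succ {k : ℕ} {F : (Fin (k + 1) → ℝ) → ℝ} (hF : Continuous F) {T : ℝ}
    (hT : 0 ≤ T) :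
    ∫ σ, F σ ∂(Measure.pi fun _ => (volume : Measure ℝ).restrict (Ioc 0 T)) =
      ∫ c in (0 : ℝ)..T, ∫ τ, F (Fin.cons c τ)
        ∂(Measure.pi fun _ : Fin k => (volume : Measure ℝ).restrict (Ioc 0 T)) := by
  have hmp := (measurePreserving_piFinSuccAbove
    (fun _ : Fin (k + 1) => (volume : Measure ℝ).restrict (Ioc 0 T)) 0).symm
  have hint := (hmp.integrable_comp_emb (MeasurableEquiv.measurableEmbedding _)).2
    (integrable_pi_of_continuous hF T)
  rw [← hmp.integral_comp', intervalIntegral.integral_of_le hT]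
  refine (integral_prod _ hint).trans ?_
  simp [MeasurableEquiv.piFinSuccAbove_symm_apply, Fin.insertNthEquiv]

/-- The integral over all paths from `a` to `b` with `k` intermediate points in `[0, T]`. -/
lemma integral_pi_path (m : ℕ) {T : ℝ} (hT : 0 ≤ T) (k : ℕ) (a b : ℝ) :
    ∫ τ : Fin k → ℝ, ∏ j : Fin (k + 1), skellam m ((Fin.cons a τ : Fin (k + 1) → ℝ) j)
      ((Fin.snoc τ b : Fin (k + 1) → ℝ) j)
        ∂(Measure.pi fun _ => (volume : Measure ℝ).restrict (Ioc 0 T)) = iterKernel m T k a b := by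
  induction k generalizing a with
  | zero =>
    have : ∀ τ : Fin 0 → ℝ, ∏ j : Fin (0 + 1), skellam m ((Fin.cons a τ : Fin (0 + 1) → ℝ) j)
      ((Fin.snoc τ b : Fin (0 + 1) → ℝ) j) = skellam m a b := fun τ => by
        simp [Fin.snoc]
    simp_rw [this]
    simp [iterKernel, measureReal_def]
  | succ k ih =>
    rw [integral_pi_succ _ hT]
    · simp only [iterKernel]
      refine intervalIntegral.integral_congr fun c _ => ?_
      simp only [← ih c, ← integral_const_mul]
      congr 1
      funext τ
      rw [Fin.prod_univ_succ, ← Fin.cons_snoc_eq_snoc_cons]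
      simp
    · have h1 : Continuous fun τ : Fin (k + 1) → ℝ => (Fin.cons a τ : Fin (k + 1 + 1) → ℝ) :=
        Continuous.finCons (A := fun _ => ℝ) continuous_const continuous_id
      have h2 : Continuous fun τ : Fin (k + 1) → ℝ => (Fin.snoc τ b : Fin (k + 1 + 1) → ℝ) :=
        Continuous.finSnoc (A := fun _ => ℝ) continuous_id continuous_const
      exact continuous_finsetProd _ fun j _ => (continuous_skellam m).comp
        (f := fun τ : Fin (k + 1) → ℝ => ((Fin.cons a τ : Fin (k + 1 + 1) → ℝ) j,
          (Fin.snoc τ b : Fin (k + 1 + 1) → ℝ) j))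
        (((continuous_apply j).comp h1).prodMk ((continuous_apply j).comp h2))

/-- The trace as the integral of an iterated kernel over the diagonal: a closed path is a path from
`a` back to `a`. -/
lemma traceI_eq_integral_iterKernel {r : ℝ} (hr : IsSmallRadius r) (N : ℕ) (x : ℤ) {t : ℝ}
    (ht : 0 ≤ t) :
    traceI r (N + 1) x t = ((∫ a in (0 : ℝ)..t, iterKernel x.natAbs t N a a : ℝ) : ℂ) := by
  rw [traceI_eq_integral hr N x ht, integral_pi_succ _ ht]
  · congr 1
    refine intervalIntegral.integral_congr fun a _ => ?_
    simp only [← integral_pi_path _ ht]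
    congr 1
    funext τ
    refine Finset.prod_congr rfl fun j _ => ?_
    rw [Fin.snoc_eq_cons_rotate]
  · exact continuous_finsetProd _ fun j _ => (continuous_skellam _).comp
      (f := fun σ : Fin (N + 1) → ℝ => (σ j, σ (finRotate _ j)))
      ((continuous_apply _).prodMk (continuous_apply _))

/-! ### Gaussian densities -/

/-- The centred Gaussian density with variance `v`. -/
noncomputable def gauss (v x : ℝ) : ℝ := (√(2 * Real.pi * v))⁻¹ * Real.exp (-x ^ 2 / (2 * v))

lemma gauss_pos {v : ℝ} (hv : 0 < v) (x : ℝ) : 0 < gauss v x := by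
  unfold gauss; positivity

lemma gauss_eq (v x : ℝ) :
    gauss v x = (√(2 * Real.pi * v))⁻¹ * Real.exp (-(2 * v)⁻¹ * x ^ 2) := by
  unfold gauss; congr 2; ring

lemma integral_gauss {v : ℝ} (hv : 0 < v) : ∫ x, gauss v x = 1 := by
  simp_rw [gauss_eq]
  rw [integral_const_mul, integral_gaussian, div_inv_eq_mul,
    show Real.pi * (2 * v) = 2 * Real.pi * v by ring]
  exact inv_mul_cancel₀ (by positivity)

/-- Gaussian densities form a convolution semigroup. -/
lemma integral_gauss_mul_gauss {u v : ℝ} (hu : 0 < u) (hv : 0 < v) (A B : ℝ) :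
    ∫ y, gauss u (A + y) * gauss v (B - y) = gauss (u + v) (A + B) := by
  -- complete the square; `w` is the variance of the remaining Gaussian variable
  set w := u * v / (u + v) with hw
  have hw0 : 0 < w := by positivity
  have h : ∀ y, gauss u (A + y) * gauss v (B - y) =
      gauss (u + v) (A + B) * gauss w (y + (A * v - B * u) / (u + v)) := fun y => by
    have hs : √(2 * Real.pi * u) * √(2 * Real.pi * v) =
        √(2 * Real.pi * (u + v)) * √(2 * Real.pi * w) := by
      rw [← Real.sqrt_mul (by positivity), ← Real.sqrt_mul (by positivity)]
      congr 1
      rw [hw]; field_simp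
    have he : -(A + y) ^ 2 / (2 * u) + -(B - y) ^ 2 / (2 * v) =
        -(A + B) ^ 2 / (2 * (u + v)) + -(y + (A * v - B * u) / (u + v)) ^ 2 / (2 * w) := by
      rw [hw]; field_simp; ring
    unfold gauss
    rw [mul_mul_mul_comm, ← mul_inv, hs, ← Real.exp_add, he, Real.exp_add, mul_inv]
    ring
  simp_rw [h]
  rw [integral_const_mul, integral_add_right_eq_self (fun y => gauss w y), integral_gauss hw0,
    mul_one]

/-- The Fourier integral of a Gaussian. -/
lemma integral_cexp_eq_gauss {s : ℝ} (hs : 0 < s) (y : ℝ) :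
    (((2 * Real.pi)⁻¹ : ℝ) : ℂ) * ∫ τ : ℝ, exp (((-(s * τ ^ 2) : ℝ) : ℂ) +
      ((y * τ : ℝ) : ℂ) * I) = (gauss (2 * s) y : ℂ) := by
  have h := fourierIntegral_gaussian (b := (s : ℂ)) (by simpa using hs) (y : ℂ)
  have h2 : ∀ τ : ℝ, exp (((-(s * τ ^ 2) : ℝ) : ℂ) + ((y * τ : ℝ) : ℂ) * I) =
      exp (I * y * τ) * exp (-s * τ ^ 2) := fun τ => by
    rw [← exp_add]; congr 1; push_cast; ring
  simp_rw [h2]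
  rw [h]
  have h3 : ((Real.pi : ℂ) / s) ^ (1 / 2 : ℂ) = ((√(Real.pi / s) : ℝ) : ℂ) := by
    rw [Real.sqrt_eq_rpow, ofReal_cpow (by positivity)]
    push_cast; rfl
  have h4 : exp (-(y : ℂ) ^ 2 / (4 * s)) = ((Real.exp (-y ^ 2 / (4 * s)) : ℝ) : ℂ) := by
    push_cast; rfl
  rw [h3, h4, ← ofReal_mul, ← ofReal_mul]
  congr 1
  have hp := Real.pi_pos
  have h5 : (2 * Real.pi)⁻¹ * √(Real.pi / s) = (√(2 * Real.pi * (2 * s)))⁻¹ := by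
    rw [← Real.sqrt_inv, ← Real.sqrt_sq (by positivity : 0 ≤ (2 * Real.pi)⁻¹),
      ← Real.sqrt_mul (by positivity)]
    congr 1
    field_simp
  rw [← mul_assoc, h5, gauss]
  congr 3; ring

/-! ### Convergence of densities -/

/-- A form of Scheffé's lemma: subprobability densities that converge pointwise to a probability
density converge in `L¹`, hence may be paired with bounded functions that converge pointwise. -/
lemma tendsto_integral_mul_of_density {ι : Type*} {l : Filter ι} [l.IsCountablyGenerated]
    {h w : ι → ℝ → ℝ} {g v : ℝ → ℝ} {C : ℝ} (hg : Integrable g) (hg0 : ∀ y, 0 ≤ g y)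
    (hh : ∀ᶠ i in l, Integrable (h i) ∧ (∀ y, 0 ≤ h i y) ∧ ∫ y, h i y ≤ ∫ y, g y)
    (hw : ∀ᶠ i in l, AEStronglyMeasurable (w i) ∧ ∀ y, |w i y| ≤ C)
    (hlim : ∀ y, Tendsto (fun i => h i y) l (𝓝 (g y)))
    (wlim : ∀ y, Tendsto (fun i => w i y) l (𝓝 (v y))) :
    Tendsto (fun i => ∫ y, h i y * w i y) l (𝓝 (∫ y, g y * v y)) := by
  -- the mass missing from `h i` tends to zero, and it controls the mass in excess
  have hpos : Tendsto (fun i => ∫ y, max (g y - h i y) 0) l (𝓝 (∫ _ : ℝ, (0 : ℝ))) := by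
    refine tendsto_integral_filter_of_dominated_convergence g ?_ ?_ hg ?_
    · filter_upwards [hh] with i hi
      exact (hg.sub hi.1).pos_part.aestronglyMeasurable
    · filter_upwards [hh] with i hi
      refine .of_forall fun y => ?_
      rw [Real.norm_of_nonneg (le_max_right _ _)]
      exact max_le (by linarith [hi.2.1 y]) (hg0 y)
    · refine .of_forall fun y => ?_
      have := ((hlim y).const_sub (g y)).max (tendsto_const_nhds (x := (0 : ℝ)))
      simpa using this
  have h1 : Tendsto (fun i => ∫ y, g y * w i y) l (𝓝 (∫ y, g y * v y)) := by
    refine tendsto_integral_filter_of_dominated_convergence (fun y => g y * C) ?_ ?_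
      (hg.mul_const C) (.of_forall fun y => (wlim y).const_mul _)
    · filter_upwards [hw] with i hi
      exact hg.aestronglyMeasurable.mul hi.1
    · filter_upwards [hw] with i hi
      refine .of_forall fun y => ?_
      rw [norm_mul, Real.norm_of_nonneg (hg0 y)]
      exact mul_le_mul_of_nonneg_left (hi.2 y) (hg0 y)
  have h2 : Tendsto (fun i => ∫ y, (h i y - g y) * w i y) l (𝓝 0) := by
    have hb : Tendsto (fun i => C * (2 * ∫ y, max (g y - h i y) 0)) l (𝓝 0) := by
      simpa using (hpos.const_mul 2).const_mul C
    refine squeeze_zero_norm' ?_ hb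
    filter_upwards [hh, hw] with i hi hwi
    have hC : 0 ≤ C := (abs_nonneg _).trans (hwi.2 0)
    have hpi : Integrable fun y => max (g y - h i y) 0 := (hg.sub hi.1).pos_part
    calc ‖∫ y, (h i y - g y) * w i y‖
        ≤ ∫ y, C * (2 * max (g y - h i y) 0 - (g y - h i y)) := by
          refine norm_integral_le_of_norm_le (((hpi.const_mul 2).sub (hg.sub hi.1)).const_mul C)
            (.of_forall fun y => ?_)
          have habs : |h i y - g y| = 2 * max (g y - h i y) 0 - (g y - h i y) := by
            rcases le_total (g y) (h i y) with hle | hle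
            · rw [max_eq_right (by linarith), abs_of_nonneg (by linarith)]; ring
            · rw [max_eq_left (by linarith), abs_of_nonpos (by linarith)]; ring
          rw [norm_mul, Real.norm_eq_abs, Real.norm_eq_abs, habs, mul_comm C]
          exact mul_le_mul_of_nonneg_left (hwi.2 y) (habs ▸ abs_nonneg _)
      _ = C * (2 * (∫ y, max (g y - h i y) 0) - ((∫ y, g y) - ∫ y, h i y)) := by
          have hgh : Integrable fun y => g y - h i y := hg.sub hi.1
          rw [integral_const_mul, integral_sub (hpi.const_mul 2) hgh,
            integral_const_mul, integral_sub hg hi.1]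
      _ ≤ C * (2 * ∫ y, max (g y - h i y) 0) := by
          gcongr; linarith [hi.2.2]
  have h3 := h1.add h2
  rw [add_zero] at h3
  refine h3.congr' ?_
  filter_upwards [hh, hw] with i hi hwi
  have hbd : ∀ᵐ y, ‖w i y‖ ≤ C := .of_forall hwi.2
  have hhg : Integrable fun y => h i y - g y := hi.1.sub hg
  rw [← integral_add (hg.mul_bdd hwi.1 hbd) (hhg.mul_bdd hwi.1 hbd)]
  congr 1; funext y; ring

/-! ### The local limit theorem -/

lemma tendsto_mul_sin_div (y : ℝ) : Tendsto (fun R : ℝ => R * Real.sin (y / R)) atTop (𝓝 y) := by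
  have h : Tendsto (fun R : ℝ => y * Real.sinc (y / R)) atTop (𝓝 (y * Real.sinc 0)) :=
    ((Real.continuous_sinc.tendsto 0).comp (tendsto_const_nhds.div_atTop tendsto_id)).const_mul y
  rw [Real.sinc_zero, mul_one] at h
  refine h.congr' ?_
  filter_upwards [eventually_gt_atTop 0] with R hR
  rcases eq_or_ne y 0 with rfl | hy
  · simp
  · rw [Real.sinc_of_ne_zero (div_ne_zero hy hR.ne')]
    field_simp

lemma tendsto_sq_mul_one_sub_cos_div (y : ℝ) :
    Tendsto (fun R : ℝ => R ^ 2 * (1 - Real.cos (y / R))) atTop (𝓝 (y ^ 2 / 2)) := by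
  have h := ((tendsto_mul_sin_div (y / 2)).pow 2).const_mul 2
  rw [show 2 * (y / 2) ^ 2 = y ^ 2 / 2 by ring] at h
  refine h.congr fun R => ?_
  have := Real.cos_sq' (y / 2 / R)
  have h2 := Real.cos_two_mul (y / 2 / R)
  rw [show 2 * (y / 2 / R) = y / R by ring] at h2
  rw [h2, this]; ring

section Asymptotics

variable {ι : Type*} {l : Filter ι} {m : ι → ℕ} {t : ι → ℝ} {c : ℝ}

/-- Fluctuations of order `√t` do not matter at scale `t`. -/
lemma eventually_half_le (ht : Tendsto t l atTop) {s : ℝ} (hs : 0 < s) (y : ℝ) :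
    ∀ᶠ i in l, t i * s / 2 ≤ t i * s + √(t i) * y := by
  have hR : Tendsto (fun i => √(t i)) l atTop := Real.tendsto_sqrt_atTop.comp ht
  filter_upwards [ht.eventually_ge_atTop 0, hR.eventually_ge_atTop (-2 * y / s)] with i h0 h1
  have h2 := mul_le_mul_of_nonneg_left ((div_le_iff₀ hs).1 h1) (Real.sqrt_nonneg (t i))
  have h3 := Real.mul_self_sqrt h0
  nlinarith

/-- Local limit theorem for the Skellam kernel, by dominated convergence in its Fourier
representation. -/
lemma tendsto_sqrt_mul_skellam [l.IsCountablyGenerated] (ht : Tendsto t l atTop)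
    (hm : Tendsto (fun i => (m i : ℝ) / √(t i)) l (𝓝 c)) {s : ℝ} (hs : 0 < s) (δ δ' : ℝ) :
    Tendsto (fun i => √(t i) * skellam (m i) (t i * s + √(t i) * δ) (t i * s + √(t i) * δ')) l
      (𝓝 (gauss (2 * s) (c + δ' - δ))) := by
  have hR : Tendsto (fun i => √(t i)) l atTop := Real.tendsto_sqrt_atTop.comp ht
  have hpi := Real.pi_pos
  -- the integrand of the Fourier representation, after the substitution `θ = τ / √t`
  set G : ι → ℝ → ℂ := fun i τ => exp (((-((2 * s + (δ + δ') / √(t i)) *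
    (√(t i) ^ 2 * (1 - Real.cos (τ / √(t i))))) : ℝ) : ℂ) + (((m i : ℝ) / √(t i) * τ +
      (δ' - δ) * (√(t i) * Real.sin (τ / √(t i))) : ℝ) : ℂ) * I) with hG
  have hGc : ∀ i, Continuous (G i) := fun i => by simp only [hG]; fun_prop
  have hlim : Tendsto (fun i => ∫ τ, (Ioc (-(Real.pi * √(t i))) (Real.pi * √(t i))).indicator
      (G i) τ) l (𝓝 (∫ τ : ℝ, exp (((-(s * τ ^ 2) : ℝ) : ℂ) +
        (((c + δ' - δ) * τ : ℝ) : ℂ) * I))) := by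
    refine tendsto_integral_filter_of_dominated_convergence
      (fun τ => Real.exp (-(2 * s / Real.pi ^ 2) * τ ^ 2)) ?_ ?_
      (integrable_exp_neg_mul_sq (by positivity)) ?_
    · exact .of_forall fun i => (hGc i).aestronglyMeasurable.indicator measurableSet_Ioc
    · filter_upwards [hR.eventually_gt_atTop 0, hR.eventually_ge_atTop (-(δ + δ') / s)]
        with i h0 h1
      refine .of_forall fun τ => ?_
      by_cases hτ : τ ∈ Ioc (-(Real.pi * √(t i))) (Real.pi * √(t i))
      · rw [indicator_of_mem hτ, hG]
        simp only [norm_exp, add_re, re_ofReal_mul, I_re, ofReal_re, mul_zero, add_zero]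
        refine Real.exp_le_exp.2 ?_
        have habs : |τ / √(t i)| ≤ Real.pi := by
          rw [abs_div, abs_of_pos h0, div_le_iff₀ h0]
          exact abs_le.2 ⟨hτ.1.le, hτ.2⟩
        have h2 := neg_mul_one_sub_cos_le (sq_nonneg (√(t i))) habs
        have h3 : s ≤ 2 * s + (δ + δ') / √(t i) := by
          have : -s ≤ (δ + δ') / √(t i) := by
            rw [le_div_iff₀ h0]
            have := (div_le_iff₀ hs).1 h1
            linarith
          linarith
        have h4 : 0 ≤ √(t i) ^ 2 * (1 - Real.cos (τ / √(t i))) :=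
          mul_nonneg (sq_nonneg _) (by linarith [Real.cos_le_one (τ / √(t i))])
        have h5 : -(2 * √(t i) ^ 2 / Real.pi ^ 2) * (τ / √(t i)) ^ 2 =
            -(2 / Real.pi ^ 2) * τ ^ 2 := by field_simp
        rw [h5] at h2
        have h6 := mul_le_mul_of_nonneg_right h3 h4
        have h7 := mul_le_mul_of_nonneg_left h2 hs.le
        calc _ ≤ s * (-√(t i) ^ 2 * (1 - Real.cos (τ / √(t i)))) := by linarith
          _ ≤ _ := h7
          _ = _ := by ring
      · rw [indicator_of_notMem hτ, norm_zero]
        exact (Real.exp_pos _).le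
    · refine .of_forall fun τ => ?_
      have hl : Tendsto (fun i => G i τ) l (𝓝 (exp (((-(s * τ ^ 2) : ℝ) : ℂ) +
          (((c + δ' - δ) * τ : ℝ) : ℂ) * I))) := by
        have e1 : Tendsto (fun i => 2 * s + (δ + δ') / √(t i)) l (𝓝 (2 * s + 0)) :=
          (tendsto_const_nhds.div_atTop hR).const_add _
        have e2 := (e1.mul ((tendsto_sq_mul_one_sub_cos_div τ).comp hR)).neg
        have e3 := (hm.mul_const τ).add
          (((tendsto_mul_sin_div τ).comp hR).const_mul (δ' - δ))
        rw [show -((2 * s + 0) * (τ ^ 2 / 2)) = -(s * τ ^ 2) by ring] at e2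
        rw [show c * τ + (δ' - δ) * τ = (c + δ' - δ) * τ by ring] at e3
        exact (((continuous_ofReal.tendsto _).comp e2).add
          (((continuous_ofReal.tendsto _).comp e3).mul_const I)).cexp
      refine hl.congr' ?_
      filter_upwards [hR.eventually_gt_atTop (|τ| / Real.pi)] with i hi
      rw [div_lt_iff₀' hpi] at hi
      rw [indicator_of_mem]
      exact ⟨(abs_lt.1 hi).1, (abs_lt.1 hi).2.le⟩
  have hlim2 := hlim.const_mul ((((2 * Real.pi)⁻¹ : ℝ) : ℂ))
  rw [integral_cexp_eq_gauss hs] at hlim2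
  have hre := (continuous_re.tendsto _).comp hlim2
  rw [ofReal_re] at hre
  refine hre.congr' ?_
  filter_upwards [hR.eventually_gt_atTop 0, ht.eventually_gt_atTop 0] with i h0 ht0
  have hsq : √(t i) ^ 2 = t i := Real.sq_sqrt ht0.le
  have h1 : ((√(t i) * skellam (m i) (t i * s + √(t i) * δ) (t i * s + √(t i) * δ') : ℝ) : ℂ) =
      (((2 * Real.pi)⁻¹ : ℝ) : ℂ) * ∫ τ,
        (Ioc (-(Real.pi * √(t i))) (Real.pi * √(t i))).indicator (G i) τ := by
    rw [integral_indicator measurableSet_Ioc, ← intervalIntegral.integral_of_le (by nlinarith),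
      ofReal_mul, skellam_eq_integral, mul_left_comm]
    congr 1
    have h2 := intervalIntegral.integral_comp_div (a := -(Real.pi * √(t i)))
      (b := Real.pi * √(t i)) (fun θ : ℝ => exp (((-((t i * s + √(t i) * δ) +
        (t i * s + √(t i) * δ')) * (1 - Real.cos θ) : ℝ) : ℂ) + ((m i * θ +
          ((t i * s + √(t i) * δ') - (t i * s + √(t i) * δ)) * Real.sin θ : ℝ) : ℂ) * I)) h0.ne'
    rw [neg_div, mul_div_cancel_right₀ _ h0.ne'] at h2
    rw [← real_smul, ← h2]
    refine intervalIntegral.integral_congr fun τ _ => ?_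
    simp only [hG]
    congr 3
    · rw [← hsq, Real.sqrt_sq h0.le]; field_simp; ring
    · congr 1; ring
  simp only [Function.comp_apply]
  rw [← h1, ofReal_re]

/-! ### Asymptotics of the iterated kernels -/

lemma iterKernel_nonneg (m : ℕ) {T : ℝ} (hT : 0 ≤ T) (k : ℕ) {a b : ℝ} (ha : 0 ≤ a)
    (hb : 0 ≤ b) : 0 ≤ iterKernel m T k a b := by
  induction k generalizing a with
  | zero => exact skellam_nonneg m ha hb
  | succ k ih =>
    exact intervalIntegral.integral_nonneg hT fun c hc =>
      mul_nonneg (skellam_nonneg m ha hc.1) (ih hc.1)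

lemma iterKernel_le_inv_sqrt (m : ℕ) {T : ℝ} (hT : 0 ≤ T) (k : ℕ) {a b : ℝ} (ha : 0 ≤ a)
    (hb : 0 < b) : iterKernel m T k a b ≤ 1 / √b := by
  induction k generalizing a with
  | zero => exact skellam_le_inv_sqrt m ha hb
  | succ k ih =>
    have hs : Continuous fun c => skellam m a c :=
      (continuous_skellam m).comp (f := fun c => (a, c)) (by fun_prop)
    have hi : Continuous fun c => iterKernel m T k c b :=
      (continuous_iterKernel m T k).comp (f := fun c => (c, b)) (by fun_prop)
    calc iterKernel m T (k + 1) a b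
        ≤ ∫ c in (0 : ℝ)..T, skellam m a c * (1 / √b) :=
          intervalIntegral.integral_mono_on hT ((hs.mul hi).intervalIntegrable _ _)
            ((hs.mul continuous_const).intervalIntegrable _ _)
            fun c hc => mul_le_mul_of_nonneg_left (ih hc.1) (skellam_nonneg m ha hc.1)
      _ ≤ 1 * (1 / √b) := by
          rw [intervalIntegral.integral_mul_const, intervalIntegral.integral_of_le hT]
          exact mul_le_mul_of_nonneg_right (integral_skellam_le m ha T) (by positivity)
      _ = 1 / √b := one_mul _

lemma integral_comp_add_mul (F : ℝ → ℝ) (a : ℝ) {R : ℝ} (hR : 0 < R) :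
    ∫ x, F x = R * ∫ y, F (a + R * y) := by
  rw [Measure.integral_comp_mul_left (fun x => F (a + x)) R, integral_add_left_eq_self F a,
    abs_of_pos (inv_pos.2 hR), smul_eq_mul, mul_inv_cancel_left₀ hR.ne']

/-- On the diffusive scale the powers of the Skellam kernel behave like Gaussian convolutions; the
restriction to `[0, t]` is not felt in the bulk. -/
lemma tendsto_sqrt_mul_iterKernel [l.IsCountablyGenerated] (ht : Tendsto t l atTop)
    (hm : Tendsto (fun i => (m i : ℝ) / √(t i)) l (𝓝 c)) {s : ℝ} (hs : 0 < s) (hs1 : s < 1)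
    (k : ℕ) (δ δ' : ℝ) :
    Tendsto (fun i => √(t i) *
      iterKernel (m i) (t i) k (t i * s + √(t i) * δ) (t i * s + √(t i) * δ')) l
      (𝓝 (gauss (2 * s * (k + 1)) ((k + 1) * c + δ' - δ))) := by
  have hR : Tendsto (fun i => √(t i)) l atTop := Real.tendsto_sqrt_atTop.comp ht
  induction k generalizing δ with
  | zero => simpa [iterKernel] using tendsto_sqrt_mul_skellam ht hm hs δ δ'
  | succ k ih =>
    have hgoal : gauss (2 * s * ((k + 1 : ℕ) + 1)) (((k + 1 : ℕ) + 1) * c + δ' - δ) =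
        ∫ y, gauss (2 * s) (c + y - δ) *
          gauss (2 * s * (k + 1)) ((k + 1) * c + δ' - y) := by
      have := integral_gauss_mul_gauss (u := 2 * s) (v := 2 * s * (k + 1)) (by positivity)
        (by positivity) (c - δ) ((k + 1) * c + δ')
      rw [show 2 * s * ((k + 1 : ℕ) + 1) = 2 * s + 2 * s * (k + 1) by push_cast; ring,
        show ((k + 1 : ℕ) + 1) * c + δ' - δ = c - δ + ((k + 1) * c + δ') by push_cast; ring,
        ← this]
      congr 1; funext y; rw [show c - δ + y = c + y - δ by ring]
    rw [hgoal]
    have hbulk : ∀ y, ∀ᶠ i in l, t i * s + √(t i) * y ∈ Ioc 0 (t i) := fun y => by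
      filter_upwards [ht.eventually_gt_atTop 0, eventually_half_le ht hs y,
        eventually_half_le ht (sub_pos.2 hs1) (-y)] with i h0 h1 h2
      have : 0 < t i * s := by positivity
      have : 0 < t i * (1 - s) := mul_pos h0 (sub_pos.2 hs1)
      exact ⟨by linarith, by linarith⟩
    have hone : ∫ y, gauss (2 * s) (c + y - δ) = 1 := by
      have : ∀ y, gauss (2 * s) (c + y - δ) = gauss (2 * s) (y + (c - δ)) := fun y => by
        congr 1; ring
      simp_rw [this]
      rw [integral_add_right_eq_self (fun y => gauss (2 * s) y), integral_gauss (by positivity)]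
    have hgi : Integrable fun y => gauss (2 * s) (c + y - δ) := by
      by_contra hni
      rw [integral_undef hni] at hone
      exact zero_ne_one hone
    -- one step of the kernel is the density `h`, the remaining steps are the bounded function `w`
    have hmain := tendsto_integral_mul_of_density (l := l)
      (h := fun i y => √(t i) * (Ioc 0 (t i)).indicator
        (fun x => skellam (m i) (t i * s + √(t i) * δ) x) (t i * s + √(t i) * y))
      (w := fun i y => √(t i) * (Ioc 0 (t i)).indicator
        (fun x => iterKernel (m i) (t i) k x (t i * s + √(t i) * δ')) (t i * s + √(t i) * y))
      (g := fun y => gauss (2 * s) (c + y - δ))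
      (v := fun y => gauss (2 * s * (k + 1)) ((k + 1) * c + δ' - y))
      (C := 1 / √(s / 2)) hgi (fun y => (gauss_pos (by positivity) _).le) ?_ ?_ ?_ ?_
    · refine hmain.congr' ?_
      filter_upwards [ht.eventually_gt_atTop 0, hR.eventually_gt_atTop 0] with i h0 hR0
      simp only [iterKernel]
      rw [intervalIntegral.integral_of_le h0.le, ← integral_indicator measurableSet_Ioc,
        integral_comp_add_mul ((Ioc 0 (t i)).indicator fun x =>
          skellam (m i) (t i * s + √(t i) * δ) x *
            iterKernel (m i) (t i) k x (t i * s + √(t i) * δ')) (t i * s) hR0,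
        ← integral_const_mul, ← integral_const_mul]
      congr 1; funext y
      by_cases hy : t i * s + √(t i) * y ∈ Ioc 0 (t i)
      · simp only [indicator_of_mem hy]; ring
      · simp only [indicator_of_notMem hy]; ring
    · filter_upwards [ht.eventually_gt_atTop 0, hR.eventually_gt_atTop 0, hbulk δ]
        with i h0 hR0 hδ
      have hs' : Continuous fun x => skellam (m i) (t i * s + √(t i) * δ) x :=
        (continuous_skellam (m i)).comp (f := fun x => (t i * s + √(t i) * δ, x)) (by fun_prop)
      have hint : Integrable ((Ioc 0 (t i)).indicator
          (fun x => skellam (m i) (t i * s + √(t i) * δ) x)) :=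
        (hs'.integrableOn_Icc.mono_set Ioc_subset_Icc_self).integrable_indicator measurableSet_Ioc
      refine ⟨((hint.comp_add_left (t i * s)).comp_mul_left' hR0.ne').const_mul _,
        fun y => mul_nonneg hR0.le (indicator_nonneg (fun x hx =>
          skellam_nonneg _ hδ.1.le hx.1.le) _), ?_⟩
      rw [hone, integral_const_mul, ← integral_comp_add_mul _ (t i * s) hR0,
        integral_indicator measurableSet_Ioc]
      exact integral_skellam_le _ hδ.1.le _
    · filter_upwards [ht.eventually_gt_atTop 0, hR.eventually_gt_atTop 0, hbulk δ',
        eventually_half_le ht hs δ'] with i h0 hR0 hδ hhalf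
      have hi : Continuous fun x => iterKernel (m i) (t i) k x (t i * s + √(t i) * δ') :=
        (continuous_iterKernel (m i) (t i) k).comp
          (f := fun x => (x, t i * s + √(t i) * δ')) (by fun_prop)
      refine ⟨?_, fun y => ?_⟩
      · have h1 : Measurable ((Ioc 0 (t i)).indicator
          (fun x => iterKernel (m i) (t i) k x (t i * s + √(t i) * δ'))) :=
          hi.measurable.indicator measurableSet_Ioc
        exact ((h1.comp (g := _) (f := fun y => t i * s + √(t i) * y)
          (by fun_prop)).const_mul _).aestronglyMeasurable
      · have hC : √(t i) * (1 / √(t i * s + √(t i) * δ')) ≤ 1 / √(s / 2) := by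
          have h2 : √(t i) * √(s / 2) ≤ √(t i * s + √(t i) * δ') := by
            rw [← Real.sqrt_mul h0.le]
            exact Real.sqrt_le_sqrt (by linarith)
          have h3 : 0 < √(s / 2) := Real.sqrt_pos.2 (by positivity)
          rw [mul_one_div, div_le_div_iff₀ (Real.sqrt_pos.2 hδ.1) h3]
          linarith
        have hnn : 0 ≤ (Ioc 0 (t i)).indicator
            (fun x => iterKernel (m i) (t i) k x (t i * s + √(t i) * δ')) (t i * s + √(t i) * y) :=
          indicator_nonneg (fun x hx => iterKernel_nonneg _ h0.le _ hx.1.le hδ.1.le) _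
        rw [abs_of_nonneg (mul_nonneg hR0.le hnn)]
        refine (mul_le_mul_of_nonneg_left ?_ hR0.le).trans hC
        refine indicator_apply_le' (fun hx => ?_) fun _ => by positivity
        exact iterKernel_le_inv_sqrt _ h0.le _ hx.1.le hδ.1
    · intro y
      refine (tendsto_sqrt_mul_skellam ht hm hs δ y).congr' ?_
      filter_upwards [hbulk y] with i hi
      rw [indicator_of_mem hi]
    · intro y
      refine (ih y).congr' ?_
      filter_upwards [hbulk y] with i hi
      rw [indicator_of_mem hi]

end Asymptotics

/-! ### The limiting integral -/

lemma integrable_exp_neg_sq : Integrable fun u : ℝ => Real.exp (-u ^ 2) := by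
  simpa using integrable_exp_neg_mul_sq one_pos

lemma erfc_eq_sub (z : ℝ) : erfc z = 2 / √Real.pi *
    ((∫ u in Ioi (0 : ℝ), Real.exp (-u ^ 2)) - ∫ u in (0 : ℝ)..z, Real.exp (-u ^ 2)) := by
  have h := intervalIntegral.integral_Ioi_sub_Ioi' (a := 0) (b := z) (μ := volume)
    integrable_exp_neg_sq.integrableOn integrable_exp_neg_sq.integrableOn
  rw [erfc, ← h, sub_sub_cancel]

lemma hasDerivAt_erfc (z : ℝ) : HasDerivAt erfc (-(2 / √Real.pi * Real.exp (-z ^ 2))) z := by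
  have hc : Continuous fun u : ℝ => Real.exp (-u ^ 2) := by fun_prop
  have h := ((hc.integral_hasStrictDerivAt 0 z).hasDerivAt.const_sub
    (∫ u in Ioi (0 : ℝ), Real.exp (-u ^ 2))).const_mul (2 / √Real.pi)
  rw [mul_neg] at h
  exact h.congr_of_eventuallyEq (.of_forall erfc_eq_sub)

lemma erfc_nonneg (z : ℝ) : 0 ≤ erfc z :=
  mul_nonneg (by positivity) (setIntegral_nonneg measurableSet_Ioi fun _ _ => (Real.exp_pos _).le)

lemma tendsto_exp_neg_sq : Tendsto (fun u : ℝ => Real.exp (-u ^ 2)) atTop (𝓝 0) :=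
  Real.tendsto_exp_neg_atTop_nhds_zero.comp (tendsto_pow_atTop two_ne_zero)

lemma hasDerivAt_exp_neg_sq (u : ℝ) :
    HasDerivAt (fun u : ℝ => Real.exp (-u ^ 2)) (-(2 * u * Real.exp (-u ^ 2))) u := by
  refine ((hasDerivAt_pow 2 u).fun_neg).exp.congr_deriv ?_
  push_cast; ring

/-- The Gaussian tail bound, from `z ≤ u` in the integral that defines `erfc z`. -/
lemma mul_erfc_le {z : ℝ} (hz : 0 ≤ z) : z * erfc z ≤ Real.exp (-z ^ 2) / √Real.pi := by
  have hd : ∀ u ∈ Ici z, HasDerivAt (fun u : ℝ => -Real.exp (-u ^ 2) / 2)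
      (u * Real.exp (-u ^ 2)) u := fun u _ => by
    refine ((hasDerivAt_exp_neg_sq u).fun_neg.div_const 2).congr_deriv ?_
    ring
  have hlim : Tendsto (fun u : ℝ => -Real.exp (-u ^ 2) / 2) atTop (𝓝 0) := by
    simpa using tendsto_exp_neg_sq.neg.div_const 2
  have hnn : ∀ u ∈ Ioi z, 0 ≤ u * Real.exp (-u ^ 2) := fun u hu =>
    mul_nonneg (hz.trans (le_of_lt hu)) (Real.exp_pos _).le
  have hint := integrableOn_Ioi_deriv_of_nonneg' hd hnn hlim
  have hval := integral_Ioi_of_hasDerivAt_of_nonneg' hd hnn hlim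
  have hle : z * ∫ u in Ioi z, Real.exp (-u ^ 2) ≤ ∫ u in Ioi z, u * Real.exp (-u ^ 2) := by
    rw [← integral_const_mul]
    exact setIntegral_mono_on (integrable_exp_neg_sq.integrableOn.const_mul z) hint
      measurableSet_Ioi fun u hu => mul_le_mul_of_nonneg_right (le_of_lt hu) (Real.exp_pos _).le
  rw [hval] at hle
  calc z * erfc z = 2 / √Real.pi * (z * ∫ u in Ioi z, Real.exp (-u ^ 2)) := by
        rw [erfc]; ring
    _ ≤ 2 / √Real.pi * (0 - -Real.exp (-z ^ 2) / 2) := by gcongr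
    _ = Real.exp (-z ^ 2) / √Real.pi := by ring

lemma tendsto_mul_erfc : Tendsto (fun z => z * erfc z) atTop (𝓝 0) := by
  refine squeeze_zero' ?_ ?_ (by simpa using tendsto_exp_neg_sq.div_const √Real.pi)
  · filter_upwards [eventually_ge_atTop 0] with z hz using mul_nonneg hz (erfc_nonneg z)
  · filter_upwards [eventually_ge_atTop 0] with z hz using mul_erfc_le hz

lemma tendsto_erfc : Tendsto erfc atTop (𝓝 0) := by
  refine squeeze_zero' (.of_forall erfc_nonneg) ?_ tendsto_mul_erfc
  filter_upwards [eventually_ge_atTop 1] with z hz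
  exact le_mul_of_one_le_left (erfc_nonneg z) hz

/-- `u * erfc u - exp (-u ^ 2) / √π` is an antiderivative of `erfc` that vanishes at infinity. -/
lemma Xi_eq (b : ℝ) : Xi b = Real.exp (-b ^ 2) / √Real.pi - b * erfc b := by
  have hd : ∀ u ∈ Ici b, HasDerivAt (fun u => u * erfc u - Real.exp (-u ^ 2) / √Real.pi)
      (erfc u) u := fun u _ => by
    refine (((hasDerivAt_id' u).fun_mul (hasDerivAt_erfc u)).fun_sub
      ((hasDerivAt_exp_neg_sq u).div_const √Real.pi)).congr_deriv ?_
    ring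
  have hlim : Tendsto (fun u => u * erfc u - Real.exp (-u ^ 2) / √Real.pi) atTop (𝓝 0) := by
    simpa using tendsto_mul_erfc.sub (tendsto_exp_neg_sq.div_const √Real.pi)
  rw [Xi, integral_Ioi_of_hasDerivAt_of_nonneg' hd (fun u _ => erfc_nonneg u) hlim]
  ring

lemma intervalIntegrable_inv_sqrt :
    IntervalIntegrable (fun s : ℝ => 1 / √s) volume 0 1 := by
  have h := intervalIntegral.intervalIntegrable_rpow' (a := 0) (b := 1)
    (show (-1 : ℝ) < -(1 / 2) by norm_num)
  refine h.congr fun s hs => ?_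
  rw [uIoc_of_le zero_le_one] at hs
  rw [Real.rpow_neg hs.1.le, ← Real.sqrt_eq_rpow, one_div]

lemma intervalIntegrable_inv_sqrt_mul_exp (b : ℝ) :
    IntervalIntegrable (fun s : ℝ => 1 / √s * Real.exp (-b ^ 2 / s)) volume 0 1 := by
  refine intervalIntegrable_inv_sqrt.mono_fun (Measurable.aestronglyMeasurable (by fun_prop)) ?_
  filter_upwards [ae_restrict_mem measurableSet_uIoc] with s hs
  rw [uIoc_of_le zero_le_one] at hs
  rw [norm_mul]
  refine mul_le_of_le_one_right (norm_nonneg _) ?_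
  rw [Real.norm_of_nonneg (Real.exp_pos _).le, Real.exp_le_one_iff, neg_div]
  exact neg_nonpos.2 (div_nonneg (sq_nonneg _) hs.1.le)

lemma integral_inv_sqrt_mul_exp {b : ℝ} (hb : 0 ≤ b) :
    ∫ s in (0 : ℝ)..1, 1 / √s * Real.exp (-b ^ 2 / s) = 2 * √Real.pi * Xi b := by
  have hpi : 0 < √Real.pi := Real.sqrt_pos.2 Real.pi_pos
  -- an antiderivative on `(0, ∞)`; at `s = 0` only its limit matters, since `b / √0 = 0` in Lean
  set F : ℝ → ℝ := fun s =>
    2 * √s * Real.exp (-(b / √s) ^ 2) - 2 * b * √Real.pi * erfc (b / √s) with hF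
  have hd : ∀ s ∈ Ioi (0 : ℝ), HasDerivAt F (1 / √s * Real.exp (-b ^ 2 / s)) s := by
    intro s hs
    have hs0 : (0 : ℝ) < s := hs
    have hq : 0 < √s := Real.sqrt_pos.2 hs0
    have hsq := (hasDerivAt_id s).sqrt hs0.ne'
    have hdiv := (hasDerivAt_const s b).div hsq hq.ne'
    have h1 := (hasDerivAt_exp_neg_sq (b / √s)).comp s hdiv
    have h2 := (hasDerivAt_erfc (b / √s)).comp s hdiv
    have h3 := ((hsq.const_mul 2).mul h1).sub (h2.const_mul (2 * b * √Real.pi))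
    refine h3.congr_deriv ?_
    have he : -(b / √s) ^ 2 = -b ^ 2 / s := by rw [div_pow, Real.sq_sqrt hs0.le, neg_div]
    simp only [id, Pi.div_apply, Function.comp_apply, he]
    have hss : s = √s ^ 2 := (Real.sq_sqrt hs0.le).symm
    field_simp
    ring
  have h0 : Tendsto F (𝓝[>] 0) (𝓝 0) := by
    have hs0 : Tendsto (fun s : ℝ => √s) (𝓝[>] 0) (𝓝[>] 0) := by
      refine tendsto_nhdsWithin_iff.2 ⟨?_, ?_⟩
      · have := (Real.continuous_sqrt.tendsto 0).mono_left (nhdsWithin_le_nhds (s := Ioi 0))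
        simpa using this
      · filter_upwards [self_mem_nhdsWithin] with s hs using Real.sqrt_pos.2 hs
    have h1 : Tendsto (fun s : ℝ => 2 * √s * Real.exp (-(b / √s) ^ 2)) (𝓝[>] 0) (𝓝 0) := by
      have hu : Tendsto (fun s : ℝ => 2 * √s) (𝓝[>] 0) (𝓝 0) := by
        simpa using (tendsto_nhds_of_tendsto_nhdsWithin hs0).const_mul 2
      refine squeeze_zero (fun s => by positivity) (fun s => ?_) hu
      refine mul_le_of_le_one_right (by positivity) (Real.exp_le_one_iff.2 ?_)
      exact neg_nonpos.2 (sq_nonneg _)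
    have h2 : Tendsto (fun s : ℝ => 2 * b * √Real.pi * erfc (b / √s)) (𝓝[>] 0) (𝓝 0) := by
      rcases hb.eq_or_lt with rfl | hb
      · simp
      · have : Tendsto (fun s : ℝ => b / √s) (𝓝[>] 0) atTop := by
          simp_rw [div_eq_mul_inv]
          exact (tendsto_inv_nhdsGT_zero.comp hs0).const_mul_atTop hb
        simpa using (tendsto_erfc.comp this).const_mul (2 * b * √Real.pi)
    simpa using h1.sub h2
  have h1 : Tendsto F (𝓝[<] 1) (𝓝 (F 1)) :=
    (hd 1 (mem_Ioi.2 one_pos)).continuousAt.tendsto.mono_left nhdsWithin_le_nhds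
  rw [intervalIntegral.integral_eq_sub_of_hasDerivAt_of_tendsto one_pos
    (fun s hs => hd s hs.1)
    (intervalIntegrable_inv_sqrt_mul_exp b) h0 h1, Xi_eq, hF]
  simp only [Real.sqrt_one, div_one, mul_one]
  field_simp
  ring

lemma integral_gauss_eq_XiN (N : ℕ) {c : ℝ} (hc : 0 ≤ c) :
    ∫ s in (0 : ℝ)..1, gauss (2 * s * (N + 1)) ((N + 1) * c) = XiN (N + 1) (c / 2) := by
  have hN : (0 : ℝ) < (N : ℝ) + 1 := by positivity
  have hpi := Real.pi_pos
  have h : ∫ s in (0 : ℝ)..1, gauss (2 * s * (N + 1)) ((N + 1) * c) =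
      ∫ s in (0 : ℝ)..1, (2 * √Real.pi * √(N + 1))⁻¹ *
        (1 / √s * Real.exp (-(√(N + 1) * (c / 2)) ^ 2 / s)) := by
    refine intervalIntegral.integral_congr_ae (.of_forall fun s hs => ?_)
    rw [uIoc_of_le zero_le_one] at hs
    have hs0 := hs.1
    have h1 : √(2 * Real.pi * (2 * s * (N + 1))) = 2 * √Real.pi * √(N + 1) * √s := by
      rw [show 2 * Real.pi * (2 * s * (N + 1)) = 2 ^ 2 * (Real.pi * (N + 1) * s) by ring,
        Real.sqrt_mul (by positivity), Real.sqrt_sq (by norm_num), Real.sqrt_mul (by positivity),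
        Real.sqrt_mul hpi.le]
      ring
    have h2 : -((N + 1) * c) ^ 2 / (2 * (2 * s * (N + 1))) =
        -(√(N + 1) * (c / 2)) ^ 2 / s := by
      rw [mul_pow √((N : ℝ) + 1), Real.sq_sqrt hN.le]
      field_simp
    rw [gauss, h1, h2, mul_inv _ √s]
    ring
  rw [h, intervalIntegral.integral_const_mul, integral_inv_sqrt_mul_exp (by positivity), XiN]
  push_cast
  field_simp

lemma Xi_pos {b : ℝ} (hb : 0 ≤ b) : 0 < Xi b := by
  have hpos : 0 < ∫ s in (0 : ℝ)..1, 1 / √s * Real.exp (-b ^ 2 / s) :=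
    intervalIntegral.intervalIntegral_pos_of_pos_on (intervalIntegrable_inv_sqrt_mul_exp b)
      (fun s hs => mul_pos (one_div_pos.2 (Real.sqrt_pos.2 hs.1)) (Real.exp_pos _)) one_pos
  rw [integral_inv_sqrt_mul_exp hb] at hpos
  exact pos_of_mul_pos_right hpos (by positivity)

lemma XiN_pos (N : ℕ) {b : ℝ} (hb : 0 ≤ b) : 0 < XiN (N + 1) b :=
  mul_pos (one_div_pos.2 (Real.sqrt_pos.2 (by positivity))) (Xi_pos (by positivity))

/-! ### Asymptotics of the trace -/

/-- The asymptotics of the trace along a countably generated filter. -/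
lemma tendsto_traceI_div_sqrt {ι : Type*} {l : Filter ι} [l.IsCountablyGenerated] {r c : ℝ}
    (hr : IsSmallRadius r) (N : ℕ) {x : ι → ℤ} {t : ι → ℝ} (hc : 0 ≤ c)
    (hx : ∀ᶠ i in l, 0 ≤ x i) (ht : Tendsto t l atTop)
    (hxt : Tendsto (fun i => (x i : ℝ) / √(t i)) l (𝓝 c)) :
    Tendsto (fun i => traceI r (N + 1) (x i) (t i) / (√(t i) : ℂ)) l
      (𝓝 (XiN (N + 1) (c / 2) : ℂ)) := by
  have hm : Tendsto (fun i => ((x i).natAbs : ℝ) / √(t i)) l (𝓝 c) := by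
    refine hxt.congr' ?_
    filter_upwards [hx] with i hi
    have : (((x i).natAbs : ℤ) : ℝ) = (x i : ℝ) := by rw [Int.natAbs_of_nonneg hi]
    rw [← this, Int.cast_natCast]
  have hlim : Tendsto (fun i => ∫ s in (0 : ℝ)..1,
      √(t i) * iterKernel (x i).natAbs (t i) N (t i * s) (t i * s)) l
      (𝓝 (∫ s in (0 : ℝ)..1, gauss (2 * s * (N + 1)) ((N + 1) * c))) := by
    refine intervalIntegral.tendsto_integral_filter_of_dominated_convergence
      (fun s => 1 / √s) ?_ ?_ intervalIntegrable_inv_sqrt ?_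
    · refine .of_forall fun i => Continuous.aestronglyMeasurable ?_
      exact ((continuous_iterKernel (x i).natAbs (t i) N).comp
        (f := fun s => (t i * s, t i * s)) (by fun_prop)).const_mul _
    · filter_upwards [ht.eventually_gt_atTop 0] with i h0
      refine .of_forall fun s hs => ?_
      rw [uIoc_of_le zero_le_one] at hs
      have hts : 0 < t i * s := mul_pos h0 hs.1
      have hR : 0 < √(t i) := Real.sqrt_pos.2 h0
      rw [Real.norm_of_nonneg (mul_nonneg hR.le
        (iterKernel_nonneg _ h0.le _ hts.le hts.le))]
      refine (mul_le_mul_of_nonneg_left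
        (iterKernel_le_inv_sqrt _ h0.le _ hts.le hts) hR.le).trans (le_of_eq ?_)
      rw [Real.sqrt_mul h0.le]
      field_simp
    -- the endpoint `s = 1`, where the cut-off at `t` is felt, is negligible
    · have hne : ∀ᵐ s : ℝ, s ≠ 1 := by simp [ae_iff]
      filter_upwards [hne] with s hs1 hs
      rw [uIoc_of_le zero_le_one] at hs
      simpa using tendsto_sqrt_mul_iterKernel ht hm hs.1 (lt_of_le_of_ne hs.2 hs1) N 0 0
  rw [integral_gauss_eq_XiN N hc] at hlim
  refine ((continuous_ofReal.tendsto _).comp hlim).congr' ?_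
  filter_upwards [ht.eventually_gt_atTop 0] with i h0
  have hsub := intervalIntegral.smul_integral_comp_mul_left (a := 0) (b := 1)
    (fun a => iterKernel (x i).natAbs (t i) N a a) (t i)
  rw [mul_zero, mul_one, smul_eq_mul] at hsub
  rw [traceI_eq_integral_iterKernel hr N _ h0.le, ← hsub, Function.comp_apply,
    intervalIntegral.integral_const_mul, ← ofReal_div]
  congr 1
  rw [eq_div_iff (Real.sqrt_pos.2 h0).ne', mul_right_comm, Real.mul_self_sqrt h0.le]

end SEP

theorem proposition3 (n : ℕ) (hn : 1 ≤ n) (r : ℝ) (hr : SEP.IsSmallRadius r) (ξ : ℝ)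
    {ι : Type*} (l : Filter ι) (x : ι → ℤ) (t : ι → ℝ)
    (hx : ∀ᶠ i in l, 0 ≤ x i)
    (ht : Tendsto t l atTop)
    (hxt : Tendsto (fun i => (x i : ℝ) / √(t i)) l (𝓝 (-2 * ξ))) :
    Tendsto (fun i => SEP.traceI r n (x i) (t i) / ((√(t i) * SEP.XiN n (-ξ) : ℝ) : ℂ)) l (𝓝 1) := by
  obtain ⟨N, rfl⟩ : ∃ N, n = N + 1 := ⟨n - 1, by omega⟩
  rcases l.eq_or_neBot with rfl | hl
  · exact tendsto_bot
  -- the hypotheses force `ξ ≤ 0`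
  have hc : 0 ≤ -2 * ξ := by
    refine ge_of_tendsto hxt ?_
    filter_upwards [hx] with i hi
    have : (0 : ℝ) ≤ x i := by exact_mod_cast hi
    positivity
  -- pass to a countably generated filter of pairs `(x, t)`, as dominated convergence needs
  set l' : Filter (ℤ × ℝ) := comap Prod.snd atTop ⊓
    comap (fun p => (p.1 : ℝ) / √p.2) (𝓝 (-2 * ξ)) ⊓ 𝓟 {p | 0 ≤ p.1} with hl'
  have hl't : Tendsto (fun i => (x i, t i)) l l' := by
    rw [hl', tendsto_inf, tendsto_inf, tendsto_comap_iff, tendsto_comap_iff, tendsto_principal]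
    exact ⟨⟨ht, hxt⟩, hx⟩
  have h1 : Tendsto (fun p : ℤ × ℝ => p.2) l' atTop :=
    tendsto_comap.mono_left (inf_le_left.trans inf_le_left)
  have h2 : Tendsto (fun p : ℤ × ℝ => (p.1 : ℝ) / √p.2) l' (𝓝 (-2 * ξ)) :=
    tendsto_comap.mono_left (inf_le_left.trans inf_le_right)
  have h3 : ∀ᶠ p : ℤ × ℝ in l', 0 ≤ p.1 :=
    (eventually_principal.2 fun _ h => h).filter_mono inf_le_right
  have h4 := (SEP.tendsto_traceI_div_sqrt hr N hc h3 h1 h2).comp hl't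
  have hpos := SEP.XiN_pos N (b := -ξ) (by linarith)
  rw [show -2 * ξ / 2 = -ξ by ring] at h4
  have h5 := h4.div_const ((SEP.XiN (N + 1) (-ξ) : ℝ) : ℂ)
  rw [div_self (by exact_mod_cast hpos.ne')] at h5
  refine h5.congr fun i => ?_
  simp only [Function.comp_apply]
  rw [div_div, Complex.ofReal_mul]
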